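/- Theorem 4.1. Let $\alpha>0$ and let $\psi:\mathbb R\to\mathbb C$ be a $2\pi$-periodic function, absolutely continuous on $[-\pi,\pi]$, for which there are constants $C,C',c>0$ such that (i) $|\psi(k)|\le C|k|^{\alpha}$ for all $k\in[-\pi,\pi]$, (ii) $|\psi'(k)|\le C'|k|^{\alpha-1}$ for almost every $k\in[-\pi,\pi]$, (iii) $\operatorname{Re}\psi(k)\le -c|k|^{\alpha}$ for all $k\in[-\pi,\pi]$. For $r\ge 1$ let $W^1_{r,per}[-\pi,\pi]$ be the space of $2\pi$-periodic functions on $\mathbb R$ that belong, together with their generalized derivative, to $L_r[-\pi,\pi]$. Then $\psi\in W^1_{2,per}[-\pi,\pi]$ if $\alpha>\frac12$, and $\psi\in W^1_{r,per}[-\pi,\pi]$ for every $1\le r<\frac1{1-\alpha}$ if $\alpha\le\frac12$. A measurable $m:\mathbb R\to\mathbb C$ is called an $L_1$-multiplier if for every $f\in L_1(\mathbb R)$ there is $v\in L_1(\mathbb R)$ with $m\hat f=\hat v$, where $\hat f(k)=\int_{\mathbb R}e^{ikx}f(x)\,dx$; then $T_mf:=v$ defines a bounded linear operator on $L_1(\mathbb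 R)$. There are constants $K$, $M$, $\theta\in(0,\frac\pi2]$ and $N$, depending only on $\alpha,c,C,C'$ (and not otherwise on $\psi$), such that the functions $\psi$, $e^{t\psi}$ $(t\ge0)$ and $\psi e^{t\psi}$ $(t>0)$ are $L_1$-multipliers and (a) $\|T_{e^{t\psi}}\|_{\mathcal B(L_1(\mathbb R))}\le K$ for all $t\ge0$, (b) $\|T_{\psi e^{t\psi}}\|_{\mathcal B(L_1(\mathbb R))}\le \dfrac Mt$ for all $t>0$. Moreover, $(T_{e^{t\psi}})_{t\ge0}$ is a strongly continuous semigroup on $L_1(\mathbb R)$ with generator $T_\psi$, and it is a bounded analytic semigroup with uniform constants: for every $z\ne0$ with $|\arg z|<\theta$ the function $e^{z\psi}$ is an $L_1$-multiplier with $\|T_{e^{z\psi}}\|_{\mathcal B(L_1(\mathbb R))}\le N$, the map $z\mapsto T_{e^{z\psi}}$ is holomorphic on this sector and satisfies $T_{e^{(z+w)\psi}}=T_{e^{z\psi}}T_{e^{w\psi}}$ there, and $T_{e^{z\psi}}f\to f$ in $L_1(\mathbb R)$ as $z\to0$ within the sector, for every $f\in L_1(\mathbb R)$. -/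

import Mathlib

open MeasureTheory Filter Topology Set
open scoped ENNReal ContDiff

/-- The Banach space `L₁(ℝ)` of complex-valued integrable functions. -/
abbrev L1R : Type := Lp ℂ 1 (volume : Measure ℝ)

/-- The Fourier transform `f̂(k) = ∫ e^{ikx} f(x) dx`. -/
noncomputable def hatF (f : L1R) (k : ℝ) : ℂ :=
  ∫ x : ℝ, Complex.exp (Complex.I * k * x) * f x

theorem integrable_hatF (f : L1R) (k : ℝ) :
    Integrable (fun x : ℝ => Complex.exp (Complex.I * k * x) * f x) := by
  have h := L1.integrable_coeFn f
  refine h.bdd_mul (c := 1) (by fun_prop) (ae_of_all _ fun x => ?_)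
  rw [Complex.norm_exp]
  simp

theorem hatF_add (f g : L1R) (k : ℝ) : hatF (f + g) k = hatF f k + hatF g k := by
  unfold hatF
  rw [← integral_add (integrable_hatF f k) (integrable_hatF g k)]
  refine integral_congr_ae ?_
  filter_upwards [Lp.coeFn_add f g] with x hx
  rw [hx, Pi.add_apply, mul_add]

theorem hatF_smul (c : ℂ) (f : L1R) (k : ℝ) : hatF (c • f) k = c * hatF f k := by
  unfold hatF
  rw [← integral_const_mul]
  refine integral_congr_ae ?_
  filter_upwards [Lp.coeFn_smul c f] with x hx
  rw [hx, Pi.smul_apply, smul_eq_mul]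
  ring

theorem hatF_sub (f g : L1R) (k : ℝ) : hatF (f - g) k = hatF f k - hatF g k := by
  have h : f - g = f + (-1 : ℂ) • g := by simp [sub_eq_add_neg]
  rw [h, hatF_add, hatF_smul]
  ring

theorem norm_hatF_le (f : L1R) (k : ℝ) : ‖hatF f k‖ ≤ ‖f‖ := by
  rw [L1.norm_eq_integral_norm]
  refine (norm_integral_le_integral_norm _).trans (le_of_eq ?_)
  congr 1
  funext x
  rw [norm_mul, Complex.norm_exp]
  simp

theorem continuous_hatF (k : ℝ) : Continuous fun f : L1R => hatF f k := by
  refine LipschitzWith.continuous (K := 1) (LipschitzWith.of_dist_le_mul fun f g => ?_)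
  rw [dist_eq_norm, dist_eq_norm, ← hatF_sub]
  simpa using norm_hatF_le (f - g) k

/-- Uniqueness of Fourier transforms on `L₁(ℝ)`. -/
theorem hatF_injective {f g : L1R} (h : ∀ k, hatF f k = hatF g k) : f = g := by
  rw [← sub_eq_zero]
  set u : L1R := f - g with hu
  have hu0 : ∀ k, hatF u k = 0 := fun k => by rw [hu, hatF_sub, h, sub_self]
  have hF : ∀ w : ℝ, FourierTransform.fourier (u : ℝ → ℂ) w = 0 := fun w => by
    rw [Real.fourier_real_eq_integral_exp_smul, ← hu0 (-2 * Real.pi * w)]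
    unfold hatF
    congr 1
    funext x
    rw [smul_eq_mul]
    congr 2
    push_cast
    ring
  have hint := L1.integrable_coeFn u
  have hS : ∀ φ : SchwartzMap ℝ ℂ, ∫ x, φ x * u x = 0 := fun φ => by
    have h1 := VectorFourier.integral_fourierIntegral_smul_eq_flip (L := innerₗ ℝ)
      (μ := (volume : Measure ℝ)) (ν := (volume : Measure ℝ))
      (f := ((FourierTransformInv.fourierInv φ : SchwartzMap ℝ ℂ) : ℝ → ℂ))
      (g := (u : ℝ → ℂ)) Real.continuous_fourierChar continuous_inner
      (SchwartzMap.integrable _) hint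
    rw [flip_innerₗ] at h1
    change ∫ ξ, FourierTransform.fourier
        ((FourierTransformInv.fourierInv φ : SchwartzMap ℝ ℂ) : ℝ → ℂ) ξ • u ξ
      = ∫ x, (FourierTransformInv.fourierInv φ : SchwartzMap ℝ ℂ) x •
        FourierTransform.fourier (u : ℝ → ℂ) x at h1
    rw [← SchwartzMap.fourier_coe, FourierTransform.fourier_fourierInv_eq] at h1
    simp only [hF, smul_eq_mul, mul_zero, integral_zero] at h1
    exact h1
  have hz : ∀ᵐ x ∂(volume : Measure ℝ), (u : ℝ → ℂ) x = 0 := by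
    refine ae_eq_zero_of_integral_contDiff_smul_eq_zero hint.locallyIntegrable
      fun φ hφ hc => ?_
    have hφc : ContDiff ℝ ∞ fun x => (φ x : ℂ) := Complex.ofRealCLM.contDiff.comp hφ
    have hcc : HasCompactSupport fun x => (φ x : ℂ) := hc.comp_left (g := Complex.ofReal) rfl
    have := hS (hcc.toSchwartzMap hφc)
    simpa using this
  exact (Lp.eq_zero_iff_ae_eq_zero).2 hz

/-- `m` is an `L₁`-multiplier: `m` is measurable and for every `f ∈ L₁(ℝ)` there is `v ∈ L₁(ℝ)`
with `m f̂ = v̂`. -/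
def IsL1Multiplier (m : ℝ → ℂ) : Prop :=
  Measurable m ∧ ∀ f : L1R, ∃ v : L1R, ∀ k, m k * hatF f k = hatF v k

/-- The everywhere defined linear operator `f ↦ v`, where `m f̂ = v̂`. -/
noncomputable def multiplierLinearMap (m : ℝ → ℂ) (hm : IsL1Multiplier m) : L1R →ₗ[ℂ] L1R where
  toFun f := (hm.2 f).choose
  map_add' f g := by
    refine hatF_injective fun k => ?_
    rw [hatF_add, ← (hm.2 _).choose_spec, ← (hm.2 f).choose_spec, ← (hm.2 g).choose_spec,
      hatF_add, mul_add]
  map_smul' c f := by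
    refine hatF_injective fun k => ?_
    rw [RingHom.id_apply, hatF_smul, ← (hm.2 _).choose_spec, ← (hm.2 f).choose_spec, hatF_smul]
    ring

theorem hatF_multiplierLinearMap (m : ℝ → ℂ) (hm : IsL1Multiplier m) (f : L1R) (k : ℝ) :
    hatF (multiplierLinearMap m hm f) k = m k * hatF f k :=
  ((hm.2 f).choose_spec k).symm

open Classical in
/-- The bounded operator `T_m` on `L₁(ℝ)` with `(T_m f)^ = m f̂` for an `L₁`-multiplier `m`
(bounded by the closed graph theorem). For all other `m` the value is the junk value `0`. -/
noncomputable def multiplierOp (m : ℝ → ℂ) : L1R →L[ℂ] L1R :=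
  if hm : IsL1Multiplier m then
    ContinuousLinearMap.ofSeqClosedGraph (g := multiplierLinearMap m hm) (by
      intro u x y hx hy
      refine hatF_injective fun k => ?_
      have h1 := ((continuous_hatF k).tendsto y).comp hy
      have h2 := (((continuous_hatF k).tendsto x).comp hx).const_mul (m k)
      refine tendsto_nhds_unique h1 ?_
      rw [hatF_multiplierLinearMap]
      refine h2.congr fun n => ?_
      simp [hatF_multiplierLinearMap])
  else 0

theorem hatF_multiplierOp {m : ℝ → ℂ} (hm : IsL1Multiplier m) (f : L1R) (k : ℝ) :
    hatF (multiplierOp m f) k = m k * hatF f k := by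
  rw [multiplierOp, dif_pos hm]
  exact hatF_multiplierLinearMap m hm f k

/-- `g'` is the generalized (distributional) derivative of `g` on `ℝ`. -/
def IsGeneralizedDeriv (g g' : ℝ → ℂ) : Prop :=
  ∀ φ : ℝ → ℝ, ContDiff ℝ ∞ φ → HasCompactSupport φ →
    ∫ x, deriv φ x • g x = -∫ x, φ x • g' x

/-- The Sobolev space `W¹_{r,per}[-π,π]` (for `1 ≤ r`): `2π`-periodic functions on `ℝ` such that
the function and its generalized derivative belong to `L_r[-π,π]`. -/
def MemW1per (r : ℝ≥0∞) (g : ℝ → ℂ) : Prop :=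
  Function.Periodic g (2 * Real.pi) ∧
  MemLp g r (volume.restrict (Icc (-Real.pi) Real.pi)) ∧
  ∃ g' : ℝ → ℂ, Function.Periodic g' (2 * Real.pi) ∧
    MemLp g' r (volume.restrict (Icc (-Real.pi) Real.pi)) ∧ IsGeneralizedDeriv g g'

/-- The assumptions on the symbol `ψ`: it is `2π`-periodic and absolutely continuous, and on the
period `[-π,π]` one has `|ψ(k)| ≤ C|k|^α`, `|ψ'(k)| ≤ C'|k|^{α-1}` for almost every `k` (where the
derivative exists), and `Re ψ(k) ≤ -c|k|^α`. -/
structure IsAdmissibleSymbol (α C C' c : ℝ) (ψ : ℝ → ℂ) : Prop where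
  periodic : Function.Periodic ψ (2 * Real.pi)
  absolutelyContinuous : AbsolutelyContinuousOnInterval ψ (-Real.pi) Real.pi
  norm_le : ∀ k ∈ Icc (-Real.pi) Real.pi, ‖ψ k‖ ≤ C * |k| ^ α
  norm_deriv_le : ∀ᵐ k : ℝ, k ∈ Icc (-Real.pi) Real.pi → ‖deriv ψ k‖ ≤ C' * |k| ^ (α - 1)
  re_le : ∀ k ∈ Icc (-Real.pi) Real.pi, (ψ k).re ≤ -c * |k| ^ α

section Semigroups

variable {X : Type*} [NormedAddCommGroup X] [NormedSpace ℂ X]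

/-- `(S t)_{t ≥ 0}` is a strongly continuous semigroup of bounded operators (only the values at
`t ≥ 0` matter). -/
structure IsC0Semigroup (S : ℝ → X →L[ℂ] X) : Prop where
  map_zero : S 0 = 1
  map_add : ∀ s t, 0 ≤ s → 0 ≤ t → S (s + t) = S s * S t
  continuousOn : ∀ x, ContinuousOn (fun t => S t x) (Ici 0)

/-- The everywhere defined bounded operator `A` is the generator of `(S t)_{t ≥ 0}`. -/
def IsBoundedGenerator (A : X →L[ℂ] X) (S : ℝ → X →L[ℂ] X) : Prop :=
  ∀ x, Tendsto (fun t : ℝ => ((t : ℂ)⁻¹) • (S t x - x)) (𝓝[>] 0) (𝓝 (A x))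

/-- The open sector `{z ≠ 0 : |arg z| < θ}`. -/
def openSector (θ : ℝ) : Set ℂ := {z | z ≠ 0 ∧ |z.arg| < θ}

/-- `(S z)`, `z` in the open sector of half-angle `θ`, together with `S 0 = 1`, is a bounded
analytic semigroup of angle `θ ∈ (0, π/2]` with norm bound `N`. -/
structure IsBoundedAnalyticSemigroup (S : ℂ → X →L[ℂ] X) (θ N : ℝ) : Prop where
  angle_pos : 0 < θ
  angle_le : θ ≤ Real.pi / 2
  map_zero : S 0 = 1
  map_add : ∀ z ∈ openSector θ, ∀ w ∈ openSector θ, S (z + w) = S z * S w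
  differentiableOn : DifferentiableOn ℂ S (openSector θ)
  tendsto_zero : ∀ x, Tendsto (fun z => S z x) (𝓝[openSector θ] 0) (𝓝 x)
  norm_le : ∀ z ∈ openSector θ, ‖S z‖ ≤ N

end Semigroups

/-! ### Periodic absolutely continuous functions -/

theorem deriv_periodic {F : Type*} [NormedAddCommGroup F] [NormedSpace ℝ F] {u : ℝ → F} {T : ℝ}
    (h : Function.Periodic u T) : Function.Periodic (deriv u) T := fun x => by
  rw [← deriv_comp_add_const]
  congr 1
  exact funext h

theorem intervalIntegrable_deriv_of_periodic {u : ℝ → ℝ} (hp : Function.Periodic u (2 * Real.pi))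
    (hu : AbsolutelyContinuousOnInterval u (-Real.pi) Real.pi) (a b : ℝ) :
    IntervalIntegrable (deriv u) volume a b := by
  refine (deriv_periodic hp).intervalIntegrable (t := -Real.pi) (by positivity) ?_ a b
  have : -Real.pi + 2 * Real.pi = Real.pi := by ring
  rw [this]
  exact hu.intervalIntegrable_deriv

theorem integral_deriv_eq_sub_of_periodic {u : ℝ → ℝ} (hp : Function.Periodic u (2 * Real.pi))
    (hu : AbsolutelyContinuousOnInterval u (-Real.pi) Real.pi) (a b : ℝ) :
    ∫ x in a..b, deriv u x = u b - u a := by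
  have hi := intervalIntegrable_deriv_of_periodic hp hu
  have hpi := Real.pi_pos
  set P : ℝ → ℝ := fun x => u x - ∫ t in (-Real.pi)..x, deriv u t with hP
  have hper : Function.Periodic P (2 * Real.pi) := fun x => by
    have h1 := intervalIntegral.integral_add_adjacent_intervals (hi (-Real.pi) x)
      (hi x (x + 2 * Real.pi))
    have h2 := (deriv_periodic hp).intervalIntegral_add_eq x (-Real.pi)
    have h3 : -Real.pi + 2 * Real.pi = Real.pi := by ring
    have h4 := hp (-Real.pi)
    rw [h3] at h4 h2
    rw [hu.integral_deriv_eq_sub, h4, sub_self] at h2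
    simp only [hP, hp x]
    rw [← h1, h2, add_zero]
  have hconst : ∀ x, P x = u (-Real.pi) := fun x => by
    obtain ⟨y, hy, hxy⟩ := hper.exists_mem_Ico (by positivity) x (-Real.pi)
    rw [hxy]
    have hy' : y ∈ Icc (-Real.pi) Real.pi := ⟨hy.1, by linarith [hy.2]⟩
    have h1 : AbsolutelyContinuousOnInterval u (-Real.pi) y := hu.mono (by
      rw [uIcc_of_le hy.1, uIcc_of_le (by linarith)]
      exact Icc_subset_Icc le_rfl hy'.2)
    simp [hP, h1.integral_deriv_eq_sub]
  have ha := hconst a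
  have hb := hconst b
  have h1 := intervalIntegral.integral_add_adjacent_intervals (hi (-Real.pi) a) (hi a b)
  simp only [hP] at ha hb
  linarith

theorem absolutelyContinuousOnInterval_of_periodic {u : ℝ → ℝ}
    (hp : Function.Periodic u (2 * Real.pi))
    (hu : AbsolutelyContinuousOnInterval u (-Real.pi) Real.pi) (a b : ℝ) :
    AbsolutelyContinuousOnInterval u a b := by
  have h1 := (intervalIntegrable_deriv_of_periodic hp hu a b)
    |>.absolutelyContinuousOnInterval_intervalIntegral (c := a) (by simp)
  have h2 : AbsolutelyContinuousOnInterval (fun _ : ℝ => u a) a b :=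
    (LipschitzWith.const (u a)).lipschitzOnWith.absolutelyContinuousOnInterval
  refine Eq.mp ?_ (h1.add h2)
  congr 1
  funext x
  simp [integral_deriv_eq_sub_of_periodic hp hu a x]

theorem ae_differentiableAt_of_periodic {u : ℝ → ℝ} (hp : Function.Periodic u (2 * Real.pi))
    (hu : AbsolutelyContinuousOnInterval u (-Real.pi) Real.pi) :
    ∀ᵐ x : ℝ, DifferentiableAt ℝ u x := by
  have h : ∀ n : ℕ, ∀ᵐ x : ℝ, x ∈ uIcc (-(n : ℝ)) n → DifferentiableAt ℝ u x := fun n =>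
    (absolutelyContinuousOnInterval_of_periodic hp hu _ _).ae_differentiableAt
  filter_upwards [ae_all_iff.2 h] with x hx
  obtain ⟨n, hn⟩ := exists_nat_ge |x|
  refine hx n ?_
  rw [uIcc_of_le (by simp)]
  exact abs_le.1 hn

theorem integral_deriv_mul_of_periodic {u : ℝ → ℝ} (hp : Function.Periodic u (2 * Real.pi))
    (hu : AbsolutelyContinuousOnInterval u (-Real.pi) Real.pi) {φ : ℝ → ℝ}
    (hφ : ContDiff ℝ ∞ φ) (hc : HasCompactSupport φ) :
    ∫ x, deriv φ x * u x = -∫ x, φ x * deriv u x := by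
  obtain ⟨R, hR0, hR⟩ := hc.isCompact.isBounded.exists_pos_norm_lt
  have hsupp : tsupport φ ⊆ Ioo (-R) R := fun x hx => abs_lt.1 (hR x hx)
  have hφ1 : AbsolutelyContinuousOnInterval φ (-R) R :=
    (hφ.of_le (by simp)).contDiffOn.absolutelyContinuousOnInterval
  have h := hφ1.integral_mul_deriv_eq_deriv_mul
    (absolutelyContinuousOnInterval_of_periodic hp hu (-R) R)
  have hz : ∀ x, x ∉ Ioo (-R) R → φ x = 0 := fun x hx =>
    image_eq_zero_of_notMem_tsupport fun h => hx (hsupp h)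
  rw [hz R (by simp), hz (-R) (by simp)] at h
  rw [intervalIntegral.integral_eq_integral_of_support_subset,
    intervalIntegral.integral_eq_integral_of_support_subset] at h
  · simp only [zero_mul, sub_zero, zero_sub] at h
    rw [h, neg_neg]
  · refine fun x hx => Ioo_subset_Ioc_self (hsupp ?_)
    exact (tsupport_deriv_subset) (subset_tsupport _ (left_ne_zero_of_mul hx))
  · exact fun x hx => Ioo_subset_Ioc_self (hsupp (subset_tsupport _ (left_ne_zero_of_mul hx)))

section ComplexSymbol

variable {ψ : ℝ → ℂ}

theorem AbsolutelyContinuousOnInterval.lipschitz_comp {X Y : Type*} [PseudoMetricSpace X]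
    [PseudoMetricSpace Y] {f : ℝ → X} {a b : ℝ} (hf : AbsolutelyContinuousOnInterval f a b)
    {g : X → Y} (hg : LipschitzWith 1 g) : AbsolutelyContinuousOnInterval (g ∘ f) a b := by
  rw [absolutelyContinuousOnInterval_iff] at hf ⊢
  intro ε hε
  obtain ⟨δ, hδ, h⟩ := hf ε hε
  refine ⟨δ, hδ, fun E hE hE' => (Finset.sum_le_sum fun i _ => ?_).trans_lt (h E hE hE')⟩
  simpa using hg.dist_le_mul (f (E.2 i).1) (f (E.2 i).2)

theorem re_absolutelyContinuous {a b : ℝ} (hu : AbsolutelyContinuousOnInterval ψ a b) :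
    AbsolutelyContinuousOnInterval (fun x => (ψ x).re) a b :=
  hu.lipschitz_comp (g := Complex.re) (LipschitzWith.of_dist_le_mul fun x y => by
    simpa [dist_eq_norm] using Complex.abs_re_le_norm (x - y))

theorem im_absolutelyContinuous {a b : ℝ} (hu : AbsolutelyContinuousOnInterval ψ a b) :
    AbsolutelyContinuousOnInterval (fun x => (ψ x).im) a b :=
  hu.lipschitz_comp (g := Complex.im) (LipschitzWith.of_dist_le_mul fun x y => by
    simpa [dist_eq_norm] using Complex.abs_im_le_norm (x - y))

theorem deriv_ae_eq_of_periodic (hp : Function.Periodic ψ (2 * Real.pi))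
    (hu : AbsolutelyContinuousOnInterval ψ (-Real.pi) Real.pi) :
    ∀ᵐ x : ℝ, deriv ψ x =
      ((deriv (fun x => (ψ x).re) x : ℝ) : ℂ) +
        ((deriv (fun x => (ψ x).im) x : ℝ) : ℂ) * Complex.I := by
  filter_upwards [ae_differentiableAt_of_periodic (hp.comp Complex.re) (re_absolutelyContinuous hu),
    ae_differentiableAt_of_periodic (hp.comp Complex.im) (im_absolutelyContinuous hu)] with x h1 h2
  have h := h1.hasDerivAt.ofReal_comp.add (h2.hasDerivAt.ofReal_comp.mul_const Complex.I)
  have h3 : HasDerivAt ψ (((deriv (fun x => (ψ x).re) x : ℝ) : ℂ) +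
      ((deriv (fun x => (ψ x).im) x : ℝ) : ℂ) * Complex.I) x := by
    refine h.congr_of_eventuallyEq (Eventually.of_forall fun y => ?_)
    simp [Complex.re_add_im]
  exact h3.deriv

theorem IntervalIntegrable.complex_ofReal {f : ℝ → ℝ} {a b : ℝ}
    (h : IntervalIntegrable f volume a b) : IntervalIntegrable (fun x => (f x : ℂ)) volume a b :=
  ⟨h.1.ofReal, h.2.ofReal⟩

theorem intervalIntegrable_deriv_complex (hp : Function.Periodic ψ (2 * Real.pi))
    (hu : AbsolutelyContinuousOnInterval ψ (-Real.pi) Real.pi) (a b : ℝ) :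
    IntervalIntegrable (deriv ψ) volume a b := by
  have h1 := (intervalIntegrable_deriv_of_periodic (hp.comp Complex.re)
    (re_absolutelyContinuous hu) a b).complex_ofReal
  have h2 := (intervalIntegrable_deriv_of_periodic (hp.comp Complex.im)
    (im_absolutelyContinuous hu) a b).complex_ofReal
  refine (h1.add (h2.mul_const Complex.I)).congr_ae ?_
  filter_upwards [ae_restrict_of_ae (deriv_ae_eq_of_periodic hp hu)] with x hx
  exact hx.symm

theorem integral_deriv_eq_sub_complex (hp : Function.Periodic ψ (2 * Real.pi))
    (hu : AbsolutelyContinuousOnInterval ψ (-Real.pi) Real.pi) (a b : ℝ) :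
    ∫ x in a..b, deriv ψ x = ψ b - ψ a := by
  have hr : IntervalIntegrable (deriv fun x => (ψ x).re) volume a b :=
    intervalIntegrable_deriv_of_periodic (hp.comp Complex.re)
    (re_absolutelyContinuous hu) a b
  have hi : IntervalIntegrable (deriv fun x => (ψ x).im) volume a b :=
    intervalIntegrable_deriv_of_periodic (hp.comp Complex.im)
    (im_absolutelyContinuous hu) a b
  have h1 : ∫ x in a..b, deriv (fun x => (ψ x).re) x = (ψ b).re - (ψ a).re :=
    integral_deriv_eq_sub_of_periodic (hp.comp Complex.re) (re_absolutelyContinuous hu) a b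
  have h2 : ∫ x in a..b, deriv (fun x => (ψ x).im) x = (ψ b).im - (ψ a).im :=
    integral_deriv_eq_sub_of_periodic (hp.comp Complex.im) (im_absolutelyContinuous hu) a b
  rw [intervalIntegral.integral_congr_ae ((deriv_ae_eq_of_periodic hp hu).mono fun x hx _ => hx),
    intervalIntegral.integral_add hr.complex_ofReal (hi.complex_ofReal.mul_const _),
    intervalIntegral.integral_mul_const, intervalIntegral.integral_ofReal,
    intervalIntegral.integral_ofReal, h1, h2]
  apply Complex.ext <;> simp

theorem isGeneralizedDeriv_deriv (hp : Function.Periodic ψ (2 * Real.pi))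
    (hu : AbsolutelyContinuousOnInterval ψ (-Real.pi) Real.pi) (hψ : Continuous ψ) :
    IsGeneralizedDeriv ψ (deriv ψ) := by
  intro φ hφ hc
  have hr := integral_deriv_mul_of_periodic (hp.comp Complex.re) (re_absolutelyContinuous hu) hφ hc
  have hi := integral_deriv_mul_of_periodic (hp.comp Complex.im) (im_absolutelyContinuous hu) hφ hc
  have hloc : LocallyIntegrable (deriv ψ) := by
    refine locallyIntegrable_iff.2 fun K hK => ?_
    obtain ⟨R, hR⟩ := hK.isBounded.subset_closedBall 0
    rw [Real.closedBall_eq_Icc] at hR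
    refine IntegrableOn.mono_set ?_ hR
    rcases le_or_gt (0 - R) (0 + R) with h | h
    · exact (intervalIntegrable_iff_integrableOn_Icc_of_le h).1
        (intervalIntegrable_deriv_complex hp hu _ _)
    · rw [Icc_eq_empty_of_lt h]
      exact integrableOn_empty
  have hint1 : Integrable fun x => deriv φ x • ψ x :=
    ((hφ.continuous_deriv (by simp)).smul hψ).integrable_of_hasCompactSupport
      (hc.deriv.smul_right)
  have hint2 : Integrable fun x => φ x • deriv ψ x :=
    hloc.integrable_smul_left_of_hasCompactSupport hφ.continuous hc
  have hae := deriv_ae_eq_of_periodic hp hu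
  apply Complex.ext
  · rw [Complex.neg_re, ← Complex.reCLM_apply, ← Complex.reCLM_apply,
      ← ContinuousLinearMap.integral_comp_comm _ hint1,
      ← ContinuousLinearMap.integral_comp_comm _ hint2]
    simp only [Complex.reCLM_apply, Complex.real_smul, Complex.re_ofReal_mul]
    refine hr.trans (congrArg _ (integral_congr_ae ?_))
    filter_upwards [hae] with x hx
    simp [hx, Function.comp_def]
  · rw [Complex.neg_im, ← Complex.imCLM_apply, ← Complex.imCLM_apply,
      ← ContinuousLinearMap.integral_comp_comm _ hint1,
      ← ContinuousLinearMap.integral_comp_comm _ hint2]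
    simp only [Complex.imCLM_apply, Complex.real_smul, Complex.im_ofReal_mul]
    refine hi.trans (congrArg _ (integral_congr_ae ?_))
    filter_upwards [hae] with x hx
    simp [hx, Function.comp_def]

theorem continuous_of_periodic_absolutelyContinuous (hp : Function.Periodic ψ (2 * Real.pi))
    (hu : AbsolutelyContinuousOnInterval ψ (-Real.pi) Real.pi) : Continuous ψ := by
  have h : ψ = fun x => ψ 0 + ∫ t in (0 : ℝ)..x, deriv ψ t := by
    funext x
    rw [integral_deriv_eq_sub_complex hp hu]
    ring
  rw [h]
  exact continuous_const.add (intervalIntegral.continuous_primitive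
    (intervalIntegrable_deriv_complex hp hu) 0)

end ComplexSymbol

/-! ### Sobolev regularity of admissible symbols -/

theorem intervalIntegrable_abs_rpow {β : ℝ} (hβ : -1 < β) (a b : ℝ) :
    IntervalIntegrable (fun x : ℝ => |x| ^ β) volume a b := by
  have hpos : ∀ c : ℝ, 0 ≤ c → IntervalIntegrable (fun x : ℝ => |x| ^ β) volume 0 c := by
    intro c hc
    refine IntervalIntegrable.congr (fun x hx => ?_)
      (intervalIntegral.intervalIntegrable_rpow' (a := 0) (b := c) hβ)
    rw [uIoc_of_le hc] at hx
    simp [abs_of_pos hx.1]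
  have h0 : ∀ c : ℝ, IntervalIntegrable (fun x : ℝ => |x| ^ β) volume 0 c := by
    intro c
    rcases le_total 0 c with hc | hc
    · exact hpos c hc
    · rw [IntervalIntegrable.iff_comp_neg]
      simpa using hpos (-c) (by linarith)
  exact (h0 a).symm.trans (h0 b)

theorem memLp_abs_rpow {r β : ℝ} (hr : 1 ≤ r) (hβ : -1 < β * r) :
    MemLp (fun x : ℝ => |x| ^ β) (ENNReal.ofReal r)
      (volume.restrict (Icc (-Real.pi) Real.pi)) := by
  have hm : AEStronglyMeasurable (fun x : ℝ => |x| ^ β)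
      (volume.restrict (Icc (-Real.pi) Real.pi)) := by
    have : Measurable fun x : ℝ => |x| ^ β := by fun_prop
    exact this.aestronglyMeasurable
  rw [← integrable_norm_rpow_iff hm (by simp; linarith) (by simp),
    ENNReal.toReal_ofReal (by linarith)]
  have h := intervalIntegrable_abs_rpow hβ (-Real.pi) Real.pi
  rw [intervalIntegrable_iff_integrableOn_Icc_of_le (by linarith [Real.pi_pos])] at h
  refine h.congr (Eventually.of_forall fun x => ?_)
  simp only [Real.norm_eq_abs]
  rw [abs_of_nonneg (Real.rpow_nonneg (abs_nonneg x) β), ← Real.rpow_mul (abs_nonneg x)]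

namespace IsAdmissibleSymbol

variable {α C C' c : ℝ} {ψ : ℝ → ℂ}

theorem continuous (h : IsAdmissibleSymbol α C C' c ψ) : Continuous ψ :=
  continuous_of_periodic_absolutelyContinuous h.periodic h.absolutelyContinuous

theorem memW1per (h : IsAdmissibleSymbol α C C' c ψ) {r : ℝ} (hr : 1 ≤ r)
    (hα : -1 < (α - 1) * r) : MemW1per (ENNReal.ofReal r) ψ := by
  refine ⟨h.periodic, ?_, deriv ψ, deriv_periodic h.periodic, ?_,
    isGeneralizedDeriv_deriv h.periodic h.absolutelyContinuous h.continuous⟩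
  · obtain ⟨B, hB⟩ := isCompact_Icc.exists_bound_of_continuousOn
      (h.continuous.continuousOn (s := Icc (-Real.pi) Real.pi))
    refine MemLp.of_bound h.continuous.aestronglyMeasurable B ?_
    filter_upwards [ae_restrict_mem measurableSet_Icc] with x hx using hB x hx
  · refine ((memLp_abs_rpow hr hα).const_mul C').mono'
      (measurable_deriv ψ).aestronglyMeasurable ?_
    rw [ae_restrict_iff' measurableSet_Icc]
    exact h.norm_deriv_le

end IsAdmissibleSymbol

/-! ### The distance to `2πℤ` -/

/-- The distance of `k` to `2πℤ`. -/
noncomputable def circDist (k : ℝ) : ℝ := ‖(k : AddCircle (2 * Real.pi))‖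

theorem circDist_nonneg (k : ℝ) : 0 ≤ circDist k := norm_nonneg _

theorem circDist_periodic : Function.Periodic circDist (2 * Real.pi) := fun k => by
  simp [circDist]

theorem circDist_eq_abs {k : ℝ} (hk : k ∈ Icc (-Real.pi) Real.pi) : circDist k = |k| := by
  have hp := Real.pi_pos
  refine (AddCircle.norm_coe_eq_abs_iff (2 * Real.pi) (by positivity)).2 ?_
  rw [abs_of_pos (by positivity : 0 < 2 * Real.pi), mul_div_cancel_left₀ _ two_ne_zero]
  exact abs_le.2 hk

theorem circDist_le_pi (k : ℝ) : circDist k ≤ Real.pi := by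
  have hp := Real.pi_pos
  have h := AddCircle.norm_le_half_period (2 * Real.pi) (x := (k : AddCircle (2 * Real.pi)))
    (by positivity)
  rwa [abs_of_pos (by positivity : 0 < 2 * Real.pi), mul_div_cancel_left₀ _ two_ne_zero] at h

theorem abs_circDist_sub_le (x y : ℝ) : |circDist x - circDist y| ≤ |x - y| := by
  refine (abs_norm_sub_norm_le _ _).trans ?_
  rw [← AddCircle.coe_sub]
  exact QuotientAddGroup.norm_mk_le_norm

theorem Function.Periodic.exists_mem_Icc_eq {F : Type*} {u : ℝ → F}
    (hu : Function.Periodic u (2 * Real.pi)) (k : ℝ) :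
    ∃ x ∈ Icc (-Real.pi) Real.pi, u k = u x ∧ circDist k = |x| := by
  have hp := Real.pi_pos
  have h : Function.Periodic (fun x => (u x, circDist x)) (2 * Real.pi) := fun x => by
    simp only [hu x, circDist_periodic x]
  obtain ⟨x, hx, hxy⟩ := h.exists_mem_Ico (by positivity) k (-Real.pi)
  have hx' : x ∈ Icc (-Real.pi) Real.pi := ⟨hx.1, by linarith [hx.2]⟩
  simp only [Prod.mk.injEq] at hxy
  exact ⟨x, hx', hxy.1, hxy.2.trans (circDist_eq_abs hx')⟩

theorem ae_circDist_of_ae_Icc {F : Type*} {u : ℝ → F} (hu : Function.Periodic u (2 * Real.pi))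
    {p : F → ℝ → Prop} (h : ∀ᵐ k : ℝ, k ∈ Icc (-Real.pi) Real.pi → p (u k) |k|) :
    ∀ᵐ k : ℝ, p (u k) (circDist k) := by
  have hp := Real.pi_pos
  have h1 : ∀ n : ℤ, ∀ᵐ k : ℝ, k + n * (2 * Real.pi) ∈ Icc (-Real.pi) Real.pi →
      p (u (k + n * (2 * Real.pi))) |k + n * (2 * Real.pi)| := fun n =>
    (measurePreserving_add_right volume _).quasiMeasurePreserving.ae h
  filter_upwards [ae_all_iff.2 h1] with k hk
  obtain ⟨n, hn, -⟩ := existsUnique_add_zsmul_mem_Ico (by positivity : 0 < 2 * Real.pi) k (-Real.pi)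
  rw [zsmul_eq_mul] at hn
  have hn' : k + n * (2 * Real.pi) ∈ Icc (-Real.pi) Real.pi := ⟨hn.1, by linarith [hn.2]⟩
  have := hk n hn'
  rwa [← circDist_eq_abs hn', hu.int_mul n k, circDist_periodic.int_mul n k] at this

theorem rpow_le_of_mem_dyadic {s d β : ℝ} (hs : 0 < s) (h1 : s / 4 ≤ d) (h2 : d ≤ 4 * s) :
    d ^ β ≤ 4 ^ |β| * s ^ β := by
  have hd : 0 < d := by linarith
  rcases le_total 0 β with hβ | hβ
  · rw [abs_of_nonneg hβ, ← Real.mul_rpow (by norm_num) hs.le]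
    exact Real.rpow_le_rpow hd.le h2 hβ
  · rw [abs_of_nonpos hβ, Real.rpow_neg (by norm_num), ← Real.inv_rpow (by norm_num),
      ← Real.mul_rpow (by norm_num) hs.le]
    refine Real.rpow_le_rpow_of_nonpos (by positivity) (by linarith) hβ

theorem le_rpow_of_mem_dyadic {s d β : ℝ} (hs : 0 < s) (hβ : 0 ≤ β) (h1 : s / 4 ≤ d) :
    4 ^ (-β) * s ^ β ≤ d ^ β := by
  rw [Real.rpow_neg (by norm_num), ← Real.inv_rpow (by norm_num),
      ← Real.mul_rpow (by norm_num) hs.le]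
  exact Real.rpow_le_rpow (by positivity) (by linarith) hβ

/-- Scale-invariant size, regularity and dissipativity of a symbol at each dyadic distance `s` from
its zeros: the consequences of admissibility that the multiplier estimates use. -/
structure DyadicSymbolBounds (α A b : ℝ) (ψ : ℝ → ℂ) : Prop where
  periodic : Function.Periodic ψ (2 * Real.pi)
  map_zero : ∀ k, circDist k = 0 → ψ k = 0
  re_nonpos : ∀ k, (ψ k).re ≤ 0
  norm_le : ∀ s k, 0 < s → s / 4 ≤ circDist k → circDist k ≤ 4 * s → ‖ψ k‖ ≤ A * s ^ α
  re_le : ∀ s k, 0 < s → s / 4 ≤ circDist k → circDist k ≤ 4 * s → (ψ k).re ≤ -b * s ^ α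
  lipschitz : ∀ s x y, 0 < s →
    (∀ z ∈ uIcc x y, s / 4 ≤ circDist z ∧ circDist z ≤ 4 * s) →
    ‖ψ x - ψ y‖ ≤ A * s ^ α / s * |x - y|

theorem IsAdmissibleSymbol.dyadicSymbolBounds {α C C' c : ℝ} {ψ : ℝ → ℂ} (hα : 0 < α) (hC : 0 < C)
    (hC' : 0 < C') (h : IsAdmissibleSymbol α C C' c ψ) {w : ℂ} (hw : ‖w‖ = 1) {c' : ℝ}
    (hc' : 0 < c')
    (hre : ∀ k d, ‖ψ k‖ ≤ C * d ^ α → (ψ k).re ≤ -c * d ^ α → 0 ≤ d →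
      (w * ψ k).re ≤ -c' * d ^ α) :
    DyadicSymbolBounds α (C * 4 ^ α + C' * 4 ^ |α - 1|) (c' * 4 ^ (-α)) (fun k => w * ψ k) := by
  have hnorm : ∀ k, ‖ψ k‖ ≤ C * circDist k ^ α := fun k => by
    obtain ⟨x, hx, h1, h2⟩ := h.periodic.exists_mem_Icc_eq k
    rw [h1, h2]
    exact h.norm_le x hx
  have hre' : ∀ k, (w * ψ k).re ≤ -c' * circDist k ^ α := fun k => by
    refine hre k _ (hnorm k) ?_ (circDist_nonneg k)
    obtain ⟨x, hx, h1, h2⟩ := h.periodic.exists_mem_Icc_eq k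
    rw [h1, h2]
    exact h.re_le x hx
  have hder : ∀ᵐ k : ℝ, ‖deriv ψ k‖ ≤ C' * circDist k ^ (α - 1) :=
    ae_circDist_of_ae_Icc (deriv_periodic h.periodic) (p := fun u d => ‖u‖ ≤ C' * d ^ (α - 1))
      h.norm_deriv_le
  refine ⟨fun k => by simp [h.periodic k], ?_, ?_, ?_, ?_, ?_⟩
  · intro k hk
    have := hnorm k
    rw [hk, Real.zero_rpow hα.ne', mul_zero] at this
    simp [norm_le_zero_iff.1 this]
  · intro k
    refine (hre' k).trans ?_
    have := Real.rpow_nonneg (circDist_nonneg k) α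
    nlinarith
  · intro s k hs h1 h2
    rw [norm_mul, hw, one_mul]
    have h3 := rpow_le_of_mem_dyadic (β := α) hs h1 h2
    rw [abs_of_pos hα] at h3
    calc ‖ψ k‖ ≤ C * circDist k ^ α := hnorm k
      _ ≤ C * (4 ^ α * s ^ α) := by gcongr
      _ ≤ C * (4 ^ α * s ^ α) + C' * 4 ^ |α - 1| * s ^ α := le_add_of_nonneg_right (by positivity)
      _ = _ := by ring
  · intro s k hs h1 h2
    refine (hre' k).trans ?_
    have h3 := le_rpow_of_mem_dyadic hs hα.le h1
    have := mul_le_mul_of_nonneg_left h3 hc'.le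
    linarith
  · intro s x y hs hxy
    rw [← mul_sub, norm_mul, hw, one_mul,
      ← integral_deriv_eq_sub_complex h.periodic h.absolutelyContinuous y x]
    have h3 : ‖∫ z in y..x, deriv ψ z‖ ≤ C' * (4 ^ |α - 1| * s ^ (α - 1)) * |x - y| := by
      refine intervalIntegral.norm_integral_le_of_norm_le_const_ae ?_
      filter_upwards [hder] with z hz hzm
      refine hz.trans ?_
      have := hxy z (by rw [uIcc_comm]; exact uIoc_subset_uIcc hzm)
      gcongr
      exact rpow_le_of_mem_dyadic hs this.1 this.2
    refine h3.trans ?_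
    gcongr
    rw [Real.rpow_sub hs, Real.rpow_one]
    calc C' * (4 ^ |α - 1| * (s ^ α / s)) ≤
        C' * (4 ^ |α - 1| * (s ^ α / s)) + C * 4 ^ α * (s ^ α / s) :=
          le_add_of_nonneg_right (by positivity)
      _ = _ := by ring

/-! ### Absolutely convergent Fourier series as `L₁`-multipliers -/

/-- The Fourier transform at a point as a continuous linear functional on `L₁(ℝ)`. -/
noncomputable def hatFCLM (k : ℝ) : L1R →L[ℂ] ℂ where
  toFun f := hatF f k
  map_add' f g := hatF_add f g k
  map_smul' c f := hatF_smul c f k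
  cont := continuous_hatF k

theorem hatFCLM_apply (k : ℝ) (f : L1R) : hatFCLM k f = hatF f k := rfl

theorem isL1Multiplier_of_forall_hatF {m : ℝ → ℂ} (hm : Measurable m) (S : L1R →L[ℂ] L1R)
    (h : ∀ f k, hatF (S f) k = m k * hatF f k) : IsL1Multiplier m ∧ multiplierOp m = S := by
  have hmul : IsL1Multiplier m := ⟨hm, fun f => ⟨S f, fun k => (h f k).symm⟩⟩
  refine ⟨hmul, ContinuousLinearMap.ext fun f => hatF_injective fun k => ?_⟩
  rw [hatF_multiplierOp hmul, h]

/-- Translation by `a` on `L₁(ℝ)`. -/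
noncomputable def translateL1 (a : ℝ) : L1R →ₗᵢ[ℂ] L1R :=
  Lp.compMeasurePreservingₗᵢ ℂ (fun x : ℝ => x - a) (measurePreserving_sub_right volume a)

theorem hatF_translateL1 (a : ℝ) (f : L1R) (k : ℝ) :
    hatF (translateL1 a f) k = Complex.exp (Complex.I * k * a) * hatF f k := by
  unfold hatF
  have h1 : (translateL1 a f : ℝ → ℂ) =ᵐ[volume] fun x => f (x - a) :=
    Lp.coeFn_compMeasurePreserving f (measurePreserving_sub_right volume a)
  rw [← integral_const_mul, ← integral_sub_right_eq_self (fun x : ℝ =>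
      Complex.exp (Complex.I * k * a) *
      (Complex.exp (Complex.I * k * x) * f x)) a]
  refine integral_congr_ae ?_
  filter_upwards [h1] with x hx
  rw [hx, ← mul_assoc, ← Complex.exp_add]
  congr 2
  push_cast
  ring

/-- `m` is the sum of a Fourier series whose coefficients have `ℓ¹`-norm at most `B`. -/
def HasWienerBound (m : ℝ → ℂ) (B : ℝ) : Prop :=
  ∃ a : ℤ → ℂ, Summable (fun n => ‖a n‖) ∧ ∑' n, ‖a n‖ ≤ B ∧
    ∀ k : ℝ, HasSum (fun n => a n * Complex.exp (Complex.I * k * n)) (m k)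

namespace HasWienerBound

theorem mono {m : ℝ → ℂ} {B B' : ℝ} (h : HasWienerBound m B) (hB : B ≤ B') :
    HasWienerBound m B' := by
  obtain ⟨a, h1, h2, h3⟩ := h
  exact ⟨a, h1, h2.trans hB, h3⟩

theorem add {m m' : ℝ → ℂ} {B B' : ℝ} (h : HasWienerBound m B) (h' : HasWienerBound m' B') :
    HasWienerBound (fun k => m k + m' k) (B + B') := by
  obtain ⟨a, h1, h2, h3⟩ := h
  obtain ⟨a', h1', h2', h3'⟩ := h'
  have hs : Summable fun n => ‖a n + a' n‖ :=
    (h1.add h1').of_nonneg_of_le (fun _ => norm_nonneg _) fun n => norm_add_le _ _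
  refine ⟨fun n => a n + a' n, hs, ?_, fun k => ?_⟩
  · calc ∑' n, ‖a n + a' n‖ ≤ ∑' n, (‖a n‖ + ‖a' n‖) :=
          hs.tsum_le_tsum (fun n => norm_add_le _ _) (h1.add h1')
      _ ≤ B + B' := by rw [h1.tsum_add h1']; exact add_le_add h2 h2'
  · simpa only [add_mul] using (h3 k).add (h3' k)

theorem hasSum {m : ℝ → ℂ} {f : ℕ → ℝ → ℂ} {B : ℕ → ℝ} {b : ℝ}
    (hf : ∀ j, HasWienerBound (f j) (B j)) (hB : HasSum B b)
    (hm : ∀ k, HasSum (fun j => f j k) (m k)) : HasWienerBound m b := by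
  choose a h1 h2 h3 using hf
  have hsum : Summable fun p : ℕ × ℤ => ‖a p.1 p.2‖ := by
    rw [summable_prod_of_nonneg fun _ => norm_nonneg _]
    exact ⟨h1, hB.summable.of_nonneg_of_le (fun j => tsum_nonneg fun _ => norm_nonneg _) h2⟩
  have hswap : Summable fun p : ℤ × ℕ => ‖a p.2 p.1‖ := hsum.prod_symm
  have hcol : ∀ n, Summable fun j => ‖a j n‖ := fun n => hswap.prod_factor n
  have hle : ∀ n, ‖∑' j, a j n‖ ≤ ∑' j, ‖a j n‖ := fun n => norm_tsum_le_tsum_norm (hcol n)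
  have hs : Summable fun n => ‖∑' j, a j n‖ :=
    hswap.prod.of_nonneg_of_le (fun _ => norm_nonneg _) hle
  refine ⟨fun n => ∑' j, a j n, hs, ?_, fun k => ?_⟩
  · calc ∑' n, ‖∑' j, a j n‖ ≤ ∑' n, ∑' j, ‖a j n‖ := hs.tsum_le_tsum hle hswap.prod
      _ = ∑' j, ∑' n, ‖a j n‖ := hsum.tsum_comm
      _ ≤ ∑' j, B j := hsum.prod.tsum_le_tsum h2 hB.summable
      _ = b := hB.tsum_eq
  · have hnorm : ∀ n : ℤ, ‖Complex.exp (Complex.I * k * n)‖ = 1 := fun n => by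
      rw [Complex.norm_exp]; simp
    have hF : Summable fun p : ℤ × ℕ => a p.2 p.1 * Complex.exp (Complex.I * k * p.1) := by
      refine Summable.of_norm ?_
      simpa only [norm_mul, hnorm, mul_one] using hswap
    have hF' : Summable fun p : ℕ × ℤ => a p.1 p.2 * Complex.exp (Complex.I * k * p.2) :=
      hF.prod_symm
    have e1 : ∀ n : ℤ, HasSum (fun j => a j n * Complex.exp (Complex.I * k * n))
        ((∑' j, a j n) * Complex.exp (Complex.I * k * n)) := fun n =>
      ((hcol n).of_norm.hasSum).mul_right _
    have e2 := hF.hasSum.prod_fiberwise e1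
    have e3 := hF'.hasSum.prod_fiberwise fun j => h3 j k
    have e4 : ∑' p : ℤ × ℕ, a p.2 p.1 * Complex.exp (Complex.I * k * p.1) =
        ∑' p : ℕ × ℤ, a p.1 p.2 * Complex.exp (Complex.I * k * p.2) :=
      (Equiv.prodComm ℤ ℕ).tsum_eq fun p : ℕ × ℤ => a p.1 p.2 * Complex.exp (Complex.I * k * p.2)
    rw [e4, e3.unique (hm k)] at e2
    exact e2

theorem continuous {m : ℝ → ℂ} {B : ℝ} (h : HasWienerBound m B) : Continuous m := by
  obtain ⟨a, h1, -, h3⟩ := h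
  have : m = fun k : ℝ => ∑' n : ℤ, a n * Complex.exp (Complex.I * k * n) :=
    funext fun k => (h3 k).tsum_eq.symm
  rw [this]
  refine continuous_tsum (fun n => by fun_prop) h1 fun n k => ?_
  rw [norm_mul, Complex.norm_exp]
  simp

theorem multiplier {m : ℝ → ℂ} {B : ℝ} (h : HasWienerBound m B) :
    IsL1Multiplier m ∧ ‖multiplierOp m‖ ≤ B := by
  have hm := h.continuous.measurable
  obtain ⟨a, h1, h2, h3⟩ := h
  have hle : ∀ n, ‖a n • (translateL1 n).toContinuousLinearMap‖ ≤ ‖a n‖ := fun n => by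
    rw [norm_smul]
    exact mul_le_of_le_one_right (norm_nonneg _) (translateL1 n).norm_toContinuousLinearMap_le
  have hs : Summable fun n => ‖a n • (translateL1 n).toContinuousLinearMap‖ :=
    h1.of_nonneg_of_le (fun _ => norm_nonneg _) hle
  obtain ⟨hmul, heq⟩ := isL1Multiplier_of_forall_hatF hm
    (∑' n : ℤ, a n • (translateL1 n).toContinuousLinearMap) (fun f k => by
      have e1 := hs.of_norm.hasSum.mapL (ContinuousLinearMap.apply ℂ L1R f)
      have e2 := e1.mapL (hatFCLM k)
      refine e2.unique ?_
      convert! (h3 k).mul_right (hatF f k) using 1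
      funext n
      simp [hatFCLM_apply, hatF_translateL1, mul_assoc])
  refine ⟨hmul, ?_⟩
  rw [heq]
  calc _ ≤ ∑' n, ‖a n • (translateL1 n).toContinuousLinearMap‖ := norm_tsum_le_tsum_norm hs
    _ ≤ ∑' n, ‖a n‖ := hs.tsum_le_tsum hle h1
    _ ≤ B := h2

end HasWienerBound

/-! ### Fourier coefficients of localized Lipschitz functions -/

theorem tsum_inv_one_add_sq_le {s : ℝ} (hs : 0 < s) (hs' : s ≤ Real.pi) :
    Summable (fun n : ℤ => 1 / (1 + s ^ 2 * (n : ℝ) ^ 2)) ∧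
      ∑' n : ℤ, 1 / (1 + s ^ 2 * (n : ℝ) ^ 2) ≤ 8 / s := by
  have hpos : ∀ n : ℕ, 0 ≤ 1 / (1 + s ^ 2 * ((n : ℝ) + 1) ^ 2) := fun n => by positivity
  have hterm : ∀ n : ℕ, 1 / (1 + s ^ 2 * ((n : ℝ) + 1) ^ 2) ≤
      2 / s * (1 / (1 + s * n)) - 2 / s * (1 / (1 + s * (n + 1))) := fun n => by
    have hn : (0 : ℝ) ≤ n := n.cast_nonneg
    have e : 2 / s * (1 / (1 + s * n)) - 2 / s * (1 / (1 + s * (n + 1))) =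
        2 / ((1 + s * n) * (1 + s * (n + 1))) := by
      have : 1 + s * n ≠ 0 := by positivity
      have : 1 + s * ((n : ℝ) + 1) ≠ 0 := by positivity
      field_simp
      ring
    rw [e, div_le_div_iff₀ (by positivity) (by positivity)]
    nlinarith [sq_nonneg (1 - s * ((n : ℝ) + 1)), mul_nonneg hs.le hn, mul_pos hs hs]
  have hsum : ∀ N : ℕ, ∑ n ∈ Finset.range N, 1 / (1 + s ^ 2 * ((n : ℝ) + 1) ^ 2) ≤ 2 / s := by
    intro N
    have h1 : ∑ n ∈ Finset.range N, 1 / (1 + s ^ 2 * ((n : ℝ) + 1) ^ 2) ≤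
        2 / s - 2 / s * (1 / (1 + s * N)) := by
      induction N with
      | zero => simp
      | succ N ih =>
        rw [Finset.sum_range_succ]
        push_cast
        linarith [hterm N]
    have : 0 ≤ 2 / s * (1 / (1 + s * N)) := by positivity
    linarith
  have h1 : Summable fun n : ℕ => 1 / (1 + s ^ 2 * ((n : ℝ) + 1) ^ 2) :=
    summable_of_sum_range_le hpos hsum
  have h2 := Real.tsum_le_of_sum_range_le hpos hsum
  have h3 : HasSum (fun n : ℕ => 1 / (1 + s ^ 2 * (n : ℝ) ^ 2))
      ((∑' n : ℕ, 1 / (1 + s ^ 2 * ((n : ℝ) + 1) ^ 2)) + 1) := by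
    rw [← hasSum_nat_add_iff' 1]
    simpa using h1.hasSum
  have h4 : HasSum (fun n : ℤ => 1 / (1 + s ^ 2 * (n : ℝ) ^ 2)) _ :=
    HasSum.of_nat_of_neg_add_one (f := fun n : ℤ => 1 / (1 + s ^ 2 * (n : ℝ) ^ 2))
      (by simpa using h3) (by
        convert! h1.hasSum using 1
        funext n
        push_cast
        ring)
  refine ⟨h4.summable, h4.tsum_eq.trans_le ?_⟩
  have h5 : 1 ≤ 4 / s := by
    rw [le_div_iff₀ hs]
    linarith [Real.pi_le_four]
  have : 8 / s = 2 / s + 2 / s + 4 / s := by ring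
  simp only [one_div] at h2 ⊢
  linarith

instance fact_two_pi_pos : Fact (0 < 2 * Real.pi) := ⟨by positivity⟩

theorem hasSum_sq_fourierCoeff_continuousMap (F : C(AddCircle (2 * Real.pi), ℂ)) :
    HasSum (fun n => ‖fourierCoeff F n‖ ^ 2) (∫ x, ‖F x‖ ^ 2 ∂AddCircle.haarAddCircle) := by
  have h := hasSum_sq_fourierCoeff (ContinuousMap.toLp (E := ℂ) 2 AddCircle.haarAddCircle ℂ F)
  simp only [fourierCoeff_toLp] at h
  convert! h using 1
  refine integral_congr_ae ?_
  filter_upwards [ContinuousMap.coeFn_toLp (p := 2) (𝕜 := ℂ) AddCircle.haarAddCircle F] with x hx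
  rw [hx]

theorem integral_sq_le_of_support (F : C(AddCircle (2 * Real.pi), ℂ)) {η ρ : ℝ} (hρ : 0 ≤ ρ)
    (hF : ∀ x, ‖F x‖ ≤ η) (hF0 : ∀ x, ρ < ‖x‖ → F x = 0) :
    ∫ x, ‖F x‖ ^ 2 ∂AddCircle.haarAddCircle ≤ η ^ 2 * ρ / Real.pi := by
  have hpi := Real.pi_pos
  have h1 : ∫ x, ‖F x‖ ^ 2 ≤ ∫ x, (Metric.closedBall (0 : AddCircle (2 * Real.pi)) ρ).indicator
      (fun _ => η ^ 2) x := by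
    refine integral_mono_of_nonneg (Eventually.of_forall fun x => by positivity)
      ((integrable_const _).indicator Metric.isClosed_closedBall.measurableSet)
      (Eventually.of_forall fun x => ?_)
    by_cases hx : x ∈ Metric.closedBall (0 : AddCircle (2 * Real.pi)) ρ
    · simp only [indicator_of_mem hx]
      exact pow_le_pow_left₀ (norm_nonneg _) (hF x) 2
    · simp only [indicator_of_notMem hx]
      rw [mem_closedBall_zero_iff, not_le] at hx
      simp [hF0 x hx]
  rw [integral_indicator Metric.isClosed_closedBall.measurableSet, setIntegral_const,
    measureReal_def, AddCircle.volume_closedBall, ENNReal.toReal_ofReal (by positivity),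
    smul_eq_mul] at h1
  rw [AddCircle.integral_haarAddCircle, smul_eq_mul]
  have h2 : min (2 * Real.pi) (2 * ρ) * η ^ 2 ≤ 2 * ρ * η ^ 2 := by
    gcongr
    exact min_le_right _ _
  calc (2 * Real.pi)⁻¹ * ∫ x, ‖F x‖ ^ 2 ≤ (2 * Real.pi)⁻¹ * (2 * ρ * η ^ 2) := by
        gcongr
        exact h1.trans h2
    _ = _ := by field_simp

theorem fourierCoeff_comp_add_right (F : C(AddCircle (2 * Real.pi), ℂ)) (h : ℝ) (n : ℤ) :
    fourierCoeff (fun x => F (x + (h : AddCircle (2 * Real.pi)))) n =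
      Complex.exp (Complex.I * n * h) * fourierCoeff F n := by
  have e : Complex.exp (Complex.I * n * h) = fourier n (h : AddCircle (2 * Real.pi)) := by
    rw [fourier_coe_apply]
    congr 1
    have : (Real.pi : ℂ) ≠ 0 := by exact_mod_cast Real.pi_ne_zero
    push_cast
    field_simp
  unfold fourierCoeff
  rw [e, ← integral_const_mul, ← integral_sub_right_eq_self _ (h : AddCircle (2 * Real.pi))]
  refine integral_congr_ae (Eventually.of_forall fun x => ?_)
  simp only [sub_add_cancel, smul_eq_mul]
  rw [← mul_assoc]
  congr 1
  have e2 : (-n) • (x - (h : AddCircle (2 * Real.pi))) =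
      n • (h : AddCircle (2 * Real.pi)) + (-n) • x := by
    rw [smul_sub, neg_smul, neg_smul]
    abel
  rw [fourier_apply, fourier_apply, fourier_apply, e2, AddCircle.toCircle_add, Circle.coe_mul]

theorem tendsto_norm_exp_sub_one_div (n : ℤ) :
    Tendsto (fun h : ℝ => ‖Complex.exp (Complex.I * n * h) - 1‖ ^ 2 / h ^ 2) (𝓝[>] 0)
      (𝓝 ((n : ℝ) ^ 2)) := by
  have h1 : HasDerivAt (fun h : ℝ => Complex.exp (Complex.I * n * h)) (Complex.I * n) 0 := by
    have := ((hasDerivAt_id (0 : ℝ)).ofReal_comp.const_mul (Complex.I * n)).cexp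
    simpa using this
  have h2 := (hasDerivAt_iff_tendsto_slope_zero.1 h1).mono_left
    (nhdsWithin_mono _ fun x (hx : 0 < x) => hx.ne')
  have h3 := (h2.norm).pow 2
  simp only [norm_mul, Complex.norm_I, one_mul, Complex.norm_intCast, sq_abs] at h3
  refine h3.congr fun h => ?_
  simp [mul_pow, div_eq_inv_mul]

/-- A function localized at distance `≲ s` from `2πℤ`, bounded by `η` and Lipschitz with constant
`η / s` at small distances, has a Wiener norm of order `η`. -/
theorem hasWienerBound_of_localized {f : ℝ → ℂ} (hf : Function.Periodic f (2 * Real.pi)) {s η : ℝ}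
    (hs : 0 < s) (hs' : s ≤ Real.pi) (hη : 0 < η) (hfη : ∀ x, ‖f x‖ ≤ η)
    (hf0 : ∀ x, 2 * s ≤ circDist x → f x = 0)
    (hlip : ∀ x y, |x - y| ≤ s / 4 → ‖f x - f y‖ ≤ η / s * |x - y|) :
    HasWienerBound f (5 * η) := by
  have hpi := Real.pi_pos
  have hpi3 := Real.pi_gt_three
  have hcont : Continuous f := by
    refine continuous_iff_continuousAt.2 fun x => ?_
    refine tendsto_iff_norm_sub_tendsto_zero.2 ?_
    have h1 : Tendsto (fun y => η / s * |y - x|) (𝓝 x) (𝓝 0) := by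
      have : Continuous fun y => η / s * |y - x| := by fun_prop
      simpa using this.tendsto x
    refine squeeze_zero' (Eventually.of_forall fun _ => norm_nonneg _) ?_ h1
    filter_upwards [Metric.closedBall_mem_nhds x (show 0 < s / 4 by positivity)] with y hy
    exact hlip y x (by simpa [Real.dist_eq] using hy)
  let F : C(AddCircle (2 * Real.pi), ℂ) :=
    ⟨hf.lift, by
      refine (QuotientAddGroup.isOpenQuotientMap_mk.isQuotientMap.continuous_iff).2 ?_
      exact hcont⟩
  have hFf : ∀ x : ℝ, F x = f x := fun x => rfl
  set a : ℤ → ℂ := fourierCoeff F with ha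
  -- Parseval for `f`
  have hP0 := hasSum_sq_fourierCoeff_continuousMap F
  have hI0 : ∫ x, ‖F x‖ ^ 2 ∂AddCircle.haarAddCircle ≤ η ^ 2 * s := by
    refine (integral_sq_le_of_support F (ρ := 2 * s) (η := η) (by positivity) ?_ ?_).trans ?_
    · intro x
      induction x using QuotientAddGroup.induction_on with
      | H x => exact hfη x
    · intro x
      induction x using QuotientAddGroup.induction_on with
      | H x => exact fun hx => hf0 x hx.le
    · rw [div_le_iff₀ hpi]
      have : 0 < η ^ 2 * s := by positivity
      nlinarith
  -- Parseval for the differences `f(· + h) - f`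
  have hPh : ∀ h : ℝ, 0 < h → h ≤ s / 4 → ∀ S : Finset ℤ,
      ∑ n ∈ S, ‖Complex.exp (Complex.I * n * h) - 1‖ ^ 2 / h ^ 2 * ‖a n‖ ^ 2 ≤ η ^ 2 / s := by
    intro h hh hhs S
    let Fh : C(AddCircle (2 * Real.pi), ℂ) :=
      ⟨fun x => F (x + (h : AddCircle (2 * Real.pi))), by fun_prop⟩
    have hc : ∀ n, fourierCoeff (Fh - F) n = (Complex.exp (Complex.I * n * h) - 1) * a n := by
      intro n
      have h1 : Integrable (⇑Fh) AddCircle.haarAddCircle :=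
        Fh.continuous.integrable_of_hasCompactSupport (HasCompactSupport.of_compactSpace _)
      have h2 : Integrable (⇑F) AddCircle.haarAddCircle :=
        F.continuous.integrable_of_hasCompactSupport (HasCompactSupport.of_compactSpace _)
      have h3 : (⇑(Fh - F) : AddCircle (2 * Real.pi) → ℂ) = ⇑Fh + (-1 : ℂ) • ⇑F := by
        funext x; simp [sub_eq_add_neg]
      rw [h3, fourierCoeff.add h1 (h2.smul _), Pi.add_apply, fourierCoeff.const_smul]
      have h4 : fourierCoeff (⇑Fh) n = Complex.exp (Complex.I * n * h) * a n :=
        fourierCoeff_comp_add_right F h n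
      rw [h4, smul_eq_mul]
      ring
    have hP := hasSum_sq_fourierCoeff_continuousMap (Fh - F)
    have hI : ∫ x, ‖(Fh - F) x‖ ^ 2 ∂AddCircle.haarAddCircle ≤ η ^ 2 / s * h ^ 2 := by
      refine (integral_sq_le_of_support (Fh - F) (ρ := 3 * s) (η := η / s * h)
        (by positivity) ?_ ?_).trans ?_
      · intro x
        induction x using QuotientAddGroup.induction_on with
        | H x =>
          have := hlip (x + h) x (by rwa [add_sub_cancel_left, abs_of_pos hh])
          rwa [add_sub_cancel_left, abs_of_pos hh] at this
      · intro x
        induction x using QuotientAddGroup.induction_on with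
        | H x =>
          intro hx
          have hx' : 3 * s < circDist x := hx
          have h1 := abs_circDist_sub_le (x + h) x
          rw [add_sub_cancel_left, abs_of_pos hh] at h1
          have h2 := (abs_le.1 h1).1
          have h3 : f (x + h) = 0 := hf0 _ (by linarith)
          have h4 : f x = 0 := hf0 _ (by linarith)
          change f (x + h) - f x = 0
          rw [h3, h4, sub_zero]
      · rw [div_le_iff₀ hpi]
        have e : (η / s * h) ^ 2 * (3 * s) = 3 * (η ^ 2 / s * h ^ 2) := by
          field_simp
        rw [e]
        have : 0 < η ^ 2 / s * h ^ 2 := by positivity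
        nlinarith
    have h5 := (sum_le_hasSum S (fun n _ => by positivity) hP).trans hI
    simp only [hc, norm_mul, mul_pow] at h5
    calc _ = (∑ n ∈ S, ‖Complex.exp (Complex.I * n * h) - 1‖ ^ 2 * ‖a n‖ ^ 2) / h ^ 2 := by
          rw [Finset.sum_div]
          exact Finset.sum_congr rfl fun n _ => by ring
      _ ≤ _ := by rwa [div_le_iff₀ (by positivity)]
  have hP1 : ∀ S : Finset ℤ, ∑ n ∈ S, (n : ℝ) ^ 2 * ‖a n‖ ^ 2 ≤ η ^ 2 / s := by
    intro S
    refine le_of_tendsto (tendsto_finsetSum S fun n _ =>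
      (tendsto_norm_exp_sub_one_div n).mul_const (‖a n‖ ^ 2)) ?_
    filter_upwards [Ioc_mem_nhdsGT (show 0 < s / 4 by positivity)] with h hh
    exact hPh h hh.1 hh.2 S
  -- Cauchy-Schwarz with the weight `1 + s²n²`
  obtain ⟨hw1, hw2⟩ := tsum_inv_one_add_sq_le hs hs'
  have hterm : ∀ n, ‖a n‖ ≤ (1 + s ^ 2 * (n : ℝ) ^ 2) * ‖a n‖ ^ 2 / (2 * (s * η)) +
      s * η / 2 * (1 / (1 + s ^ 2 * (n : ℝ) ^ 2)) := by
    intro n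
    have hq : 0 < 1 + s ^ 2 * (n : ℝ) ^ 2 := by positivity
    have e : (1 + s ^ 2 * (n : ℝ) ^ 2) * ‖a n‖ ^ 2 / (2 * (s * η)) +
        s * η / 2 * (1 / (1 + s ^ 2 * (n : ℝ) ^ 2)) - ‖a n‖ =
        ((1 + s ^ 2 * (n : ℝ) ^ 2) * ‖a n‖ - s * η) ^ 2 /
          (2 * (s * η) * (1 + s ^ 2 * (n : ℝ) ^ 2)) := by
      field_simp
      ring
    have : 0 ≤ ((1 + s ^ 2 * (n : ℝ) ^ 2) * ‖a n‖ - s * η) ^ 2 /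
          (2 * (s * η) * (1 + s ^ 2 * (n : ℝ) ^ 2)) := by positivity
    linarith
  have hsum : ∀ S : Finset ℤ, ∑ n ∈ S, ‖a n‖ ≤ 5 * η := by
    intro S
    have h0 : ∑ n ∈ S, ‖a n‖ ^ 2 ≤ η ^ 2 * s :=
      (sum_le_hasSum S (fun n _ => by positivity) hP0).trans hI0
    have h1 := hP1 S
    have h2 : ∑ n ∈ S, 1 / (1 + s ^ 2 * (n : ℝ) ^ 2) ≤ 8 / s :=
      (hw1.sum_le_tsum S fun n _ => by positivity).trans hw2
    calc ∑ n ∈ S, ‖a n‖ ≤ ∑ n ∈ S, ((1 + s ^ 2 * (n : ℝ) ^ 2) * ‖a n‖ ^ 2 / (2 * (s * η)) +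
          s * η / 2 * (1 / (1 + s ^ 2 * (n : ℝ) ^ 2))) := Finset.sum_le_sum fun n _ => hterm n
      _ = (∑ n ∈ S, ‖a n‖ ^ 2 + s ^ 2 * ∑ n ∈ S, (n : ℝ) ^ 2 * ‖a n‖ ^ 2) / (2 * (s * η)) +
          s * η / 2 * ∑ n ∈ S, 1 / (1 + s ^ 2 * (n : ℝ) ^ 2) := by
        rw [Finset.sum_add_distrib, ← Finset.mul_sum]
        congr 1
        rw [Finset.mul_sum, ← Finset.sum_add_distrib, Finset.sum_div]
        exact Finset.sum_congr rfl fun n _ => by ring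
      _ ≤ (η ^ 2 * s + s ^ 2 * (η ^ 2 / s)) / (2 * (s * η)) + s * η / 2 * (8 / s) := by gcongr
      _ = 5 * η := by field_simp; ring
  have hsa : Summable fun n => ‖a n‖ := summable_of_sum_le (fun _ => norm_nonneg _) hsum
  refine ⟨a, hsa, Real.tsum_le_of_sum_le (fun _ => norm_nonneg _) hsum, fun k => ?_⟩
  have h := has_pointwise_sum_fourier_series_of_summable hsa.of_norm (k : AddCircle (2 * Real.pi))
  rw [hFf] at h
  convert! h using 1
  funext n
  rw [smul_eq_mul, fourier_coe_apply]
  congr 2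
  have : (Real.pi : ℂ) ≠ 0 := by exact_mod_cast Real.pi_ne_zero
  push_cast
  field_simp

/-! ### Dyadic partition of unity -/

/-- The trapezoidal cut-off: `1` for `d ≤ s`, `0` for `2s ≤ d`, linear in between. -/
noncomputable def cutoff (s d : ℝ) : ℝ := max 0 (min 1 (2 - d / s))

theorem cutoff_nonneg (s d : ℝ) : 0 ≤ cutoff s d := le_max_left _ _

theorem cutoff_le_one (s d : ℝ) : cutoff s d ≤ 1 := max_le zero_le_one (min_le_left _ _)

theorem cutoff_eq_one {s d : ℝ} (hs : 0 < s) (h : d ≤ s) : cutoff s d = 1 := by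
  have : d / s ≤ 1 := (div_le_one hs).2 h
  rw [cutoff, min_eq_left (by linarith), max_eq_right zero_le_one]

theorem cutoff_eq_zero {s d : ℝ} (hs : 0 < s) (h : 2 * s ≤ d) : cutoff s d = 0 := by
  have : 2 ≤ d / s := (le_div_iff₀ hs).2 h
  rw [cutoff, max_eq_left]
  exact (min_le_right _ _).trans (by linarith)

theorem abs_cutoff_sub_le {s : ℝ} (hs : 0 < s) (d d' : ℝ) :
    |cutoff s d - cutoff s d'| ≤ |d - d'| / s := by
  have h1 : |cutoff s d - cutoff s d'| ≤ |min 1 (2 - d / s) - min 1 (2 - d' / s)| := by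
    simpa [cutoff, Real.dist_eq] using
      abs_max_sub_max_le_max 0 (min 1 (2 - d / s)) 0 (min 1 (2 - d' / s))
  have h2 : |min 1 (2 - d / s) - min 1 (2 - d' / s)| ≤ |(2 - d / s) - (2 - d' / s)| := by
    simpa using abs_min_sub_min_le_max 1 (2 - d / s) 1 (2 - d' / s)
  refine (h1.trans h2).trans (le_of_eq ?_)
  rw [← abs_of_pos hs, ← abs_div, abs_of_pos hs, ← abs_neg]
  congr 1
  ring

theorem cutoff_mono {s s' d : ℝ} (hs : 0 < s) (hss : s ≤ s') (hd : 0 ≤ d) :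
    cutoff s d ≤ cutoff s' d := by
  unfold cutoff
  gcongr

/-- The dyadic bump function supported in `s / 2 ≤ d ≤ 2s`. -/
noncomputable def dyadicBump (s d : ℝ) : ℝ := cutoff s d - cutoff (s / 2) d

theorem dyadicBump_nonneg {s d : ℝ} (hs : 0 < s) (hd : 0 ≤ d) : 0 ≤ dyadicBump s d :=
  sub_nonneg.2 (cutoff_mono (by positivity) (by linarith) hd)

theorem dyadicBump_le_one (s d : ℝ) : dyadicBump s d ≤ 1 := by
  have h1 := cutoff_le_one s d
  have h2 := cutoff_nonneg (s / 2) d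
  unfold dyadicBump
  linarith

theorem dyadicBump_eq_zero_of_le {s d : ℝ} (hs : 0 < s) (h : d ≤ s / 2) : dyadicBump s d = 0 := by
  rw [dyadicBump, cutoff_eq_one hs (by linarith), cutoff_eq_one (by positivity) h, sub_self]

theorem dyadicBump_eq_zero_of_ge {s d : ℝ} (hs : 0 < s) (h : 2 * s ≤ d) : dyadicBump s d = 0 := by
  rw [dyadicBump, cutoff_eq_zero hs h, cutoff_eq_zero (by positivity) (by linarith), sub_self]

theorem abs_dyadicBump_sub_le {s : ℝ} (hs : 0 < s) (d d' : ℝ) :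
    |dyadicBump s d - dyadicBump s d'| ≤ 3 / s * |d - d'| := by
  have h1 := abs_cutoff_sub_le hs d d'
  have h2 := abs_cutoff_sub_le (s := s / 2) (by positivity) d d'
  have e : dyadicBump s d - dyadicBump s d' =
      (cutoff s d - cutoff s d') - (cutoff (s / 2) d - cutoff (s / 2) d') := by
    unfold dyadicBump; ring
  rw [e]
  refine (abs_sub _ _).trans ((add_le_add h1 h2).trans (le_of_eq ?_))
  field_simp
  ring

/-- The `j`-th dyadic scale `π / 2 ^ j`. -/
noncomputable def dyadicScale (j : ℕ) : ℝ := Real.pi / 2 ^ j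

theorem dyadicScale_pos (j : ℕ) : 0 < dyadicScale j := by
  have := Real.pi_pos
  unfold dyadicScale
  positivity

theorem dyadicScale_le (j : ℕ) : dyadicScale j ≤ Real.pi :=
  div_le_self Real.pi_pos.le (one_le_pow₀ one_le_two)

theorem dyadicScale_succ (j : ℕ) : dyadicScale (j + 1) = dyadicScale j / 2 := by
  unfold dyadicScale
  rw [pow_succ]
  field_simp

theorem dyadicScale_rpow (j : ℕ) (α : ℝ) :
    dyadicScale j ^ α = Real.pi ^ α * ((2 : ℝ) ^ (-α)) ^ j := by
  unfold dyadicScale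
  rw [Real.div_rpow Real.pi_pos.le (by positivity), ← Real.rpow_natCast, ← Real.rpow_natCast,
    ← Real.rpow_mul (by norm_num), ← Real.rpow_mul (by norm_num), div_eq_mul_inv,
    ← Real.rpow_neg (by norm_num)]
  congr 2
  ring

theorem hasSum_dyadicBump {d : ℝ} (hd : 0 < d) (J : ℕ) :
    HasSum (fun j => if J ≤ j then dyadicBump (dyadicScale j) d else 0)
      (cutoff (dyadicScale J) d) := by
  have h : HasSum (fun j => dyadicBump (dyadicScale (j + J)) d) (cutoff (dyadicScale J) d) := by
    rw [hasSum_iff_tendsto_nat_of_nonneg fun j => dyadicBump_nonneg (dyadicScale_pos _) hd.le]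
    have hs : ∀ n, ∑ j ∈ Finset.range n, dyadicBump (dyadicScale (j + J)) d =
        cutoff (dyadicScale J) d - cutoff (dyadicScale (n + J)) d := by
      intro n
      induction n with
      | zero => simp
      | succ n ih =>
        rw [Finset.sum_range_succ, ih, dyadicBump, ← dyadicScale_succ, add_right_comm]
        ring
    simp only [hs]
    obtain ⟨n, hn⟩ := pow_unbounded_of_one_lt (2 * Real.pi / d) one_lt_two
    refine tendsto_const_nhds.congr' ?_
    filter_upwards [eventually_ge_atTop n] with m hm
    have h1 : (2 : ℝ) ^ n ≤ 2 ^ (m + J) := pow_le_pow_right₀ one_le_two (by omega)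
    rw [cutoff_eq_zero (dyadicScale_pos (m + J)), sub_zero]
    rw [dyadicScale, ← mul_div_assoc, div_le_iff₀ (by positivity)]
    rw [div_lt_iff₀ hd] at hn
    nlinarith
  have h2 := (hasSum_nat_add_iff (f := fun j => if J ≤ j then dyadicBump (dyadicScale j) d else 0)
    J).1 (by simpa using h)
  rwa [Finset.sum_eq_zero (fun i hi => by simp [Finset.mem_range.1 hi]), add_zero] at h2

theorem hasWienerBound_cutoff {s : ℝ} (hs : 0 < s) (hs' : s ≤ Real.pi) :
    HasWienerBound (fun k => (cutoff s (circDist k) : ℂ)) 5 := by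
  have h := hasWienerBound_of_localized (f := fun k => (cutoff s (circDist k) : ℂ)) (η := 1)
    (fun k => by simp [circDist_periodic k]) hs hs' one_pos (fun x => ?_) (fun x hx => ?_)
    fun x y _ => ?_
  · simpa using h
  · rw [Complex.norm_real, Real.norm_of_nonneg (cutoff_nonneg _ _)]
    exact cutoff_le_one _ _
  · rw [cutoff_eq_zero hs hx, Complex.ofReal_zero]
  · rw [← Complex.ofReal_sub, Complex.norm_real, Real.norm_eq_abs, div_mul_eq_mul_div, one_mul]
    exact (abs_cutoff_sub_le hs _ _).trans
      (div_le_div_of_nonneg_right (abs_circDist_sub_le x y) hs.le)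

/-- `G` is bounded by `η` and Lipschitz with constant `η / s` at distance comparable to `s` from
`2πℤ`. -/
structure BoundedAtScale (s η : ℝ) (G : ℝ → ℂ) : Prop where
  norm_le : ∀ k, s / 4 ≤ circDist k → circDist k ≤ 4 * s → ‖G k‖ ≤ η
  lipschitz : ∀ x y, (∀ z ∈ uIcc x y, s / 4 ≤ circDist z ∧ circDist z ≤ 4 * s) →
    ‖G x - G y‖ ≤ η / s * |x - y|

theorem BoundedAtScale.mono {s η η' : ℝ} {G : ℝ → ℂ} (hs : 0 < s) (h : BoundedAtScale s η G)
    (hη : η ≤ η') : BoundedAtScale s η' G :=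
  ⟨fun k h1 h2 => (h.norm_le k h1 h2).trans hη, fun x y hxy => (h.lipschitz x y hxy).trans (by
    gcongr)⟩

theorem BoundedAtScale.hasWienerBound {s η : ℝ} {G : ℝ → ℂ} (hs : 0 < s) (hs' : s ≤ Real.pi)
    (hη : 0 < η) (hG : Function.Periodic G (2 * Real.pi)) (h : BoundedAtScale s η G) :
    HasWienerBound (fun k => (dyadicBump s (circDist k) : ℂ) * G k) (20 * η) := by
  set τ : ℝ → ℝ := fun k => dyadicBump s (circDist k) with hτ
  have hτ0 : ∀ k, 0 ≤ τ k := fun k => dyadicBump_nonneg hs (circDist_nonneg k)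
  have hτ1 : ∀ k, τ k ≤ 1 := fun k => dyadicBump_le_one _ _
  have hτL : ∀ x y, |τ x - τ y| ≤ 3 / s * |x - y| := fun x y =>
    (abs_dyadicBump_sub_le hs _ _).trans
      (mul_le_mul_of_nonneg_left (abs_circDist_sub_le x y) (by positivity))
  have hsupp : ∀ k, τ k ≠ 0 → s / 2 ≤ circDist k ∧ circDist k ≤ 2 * s := fun k hk => by
    constructor
    · by_contra! hlt
      exact hk (dyadicBump_eq_zero_of_le hs hlt.le)
    · by_contra! hlt
      exact hk (dyadicBump_eq_zero_of_ge hs hlt.le)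
  have hGs : ∀ k, τ k ≠ 0 → ‖G k‖ ≤ η := fun k hk =>
    h.norm_le k (by linarith [(hsupp k hk).1]) (by linarith [(hsupp k hk).2])
  have hnorm : ∀ k, ‖(τ k : ℂ)‖ = τ k := fun k => by
    rw [Complex.norm_real, Real.norm_of_nonneg (hτ0 k)]
  -- the increment of `τ` times a value of `G` on the support of `τ`
  have hinc : ∀ x y k, τ k ≠ 0 → ‖((τ x : ℂ) - τ y) * G k‖ ≤ 3 / s * |x - y| * η := by
    intro x y k hk
    rw [norm_mul, ← Complex.ofReal_sub, Complex.norm_real, Real.norm_eq_abs]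
    exact mul_le_mul (hτL x y) (hGs k hk) (norm_nonneg _) (by positivity)
  have hfin : ∀ r : ℝ, 3 / s * |r| * η ≤ 4 * η / s * |r| := fun r => by
    have : 0 ≤ η / s * |r| := by positivity
    calc 3 / s * |r| * η = 3 * (η / s * |r|) := by ring
      _ ≤ 4 * (η / s * |r|) := by linarith
      _ = _ := by ring
  have hmain := hasWienerBound_of_localized (f := fun k => (τ k : ℂ) * G k) (s := s) (η := 4 * η)
    (fun k => by simp only [hτ, circDist_periodic k, hG k]) hs hs' (by positivity)
    (fun x => ?_) (fun x hx => ?_) fun x y hxy => ?_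
  · exact hmain.mono (by linarith)
  · by_cases hx : τ x = 0
    · simp only [hx, Complex.ofReal_zero, zero_mul, norm_zero]
      positivity
    · rw [norm_mul, hnorm]
      nlinarith [hGs x hx, hτ0 x, hτ1 x, norm_nonneg (G x)]
  · simp only [hτ, dyadicBump_eq_zero_of_ge hs hx, Complex.ofReal_zero, zero_mul]
  · by_cases hx : τ x = 0
    · by_cases hy : τ y = 0
      · simp only [hx, hy, Complex.ofReal_zero, zero_mul, sub_zero, norm_zero]
        positivity
      · have := hinc x y y hy
        rw [sub_mul, hx, Complex.ofReal_zero, zero_mul] at this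
        simp only [hx, Complex.ofReal_zero, zero_mul]
        exact this.trans (hfin _)
    · by_cases hy : τ y = 0
      · have := hinc x y x hx
        rw [sub_mul, hy, Complex.ofReal_zero, zero_mul] at this
        simp only [hy, Complex.ofReal_zero, zero_mul]
        exact this.trans (hfin _)
      · have hseg : ∀ z ∈ uIcc x y, s / 4 ≤ circDist z ∧ circDist z ≤ 4 * s := by
          intro z hz
          have h1 : |z - x| ≤ |x - y| := by
            rw [abs_sub_comm x y]
            exact abs_sub_left_of_mem_uIcc hz
          have h2 := abs_le.1 ((abs_circDist_sub_le z x).trans (h1.trans hxy))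
          have h3 := hsupp x hx
          constructor <;> linarith [h2.1, h2.2, h3.1, h3.2]
        have e : (τ x : ℂ) * G x - τ y * G y = ((τ x : ℂ) - τ y) * G x + τ y * (G x - G y) := by
          ring
        rw [e]
        refine (norm_add_le _ _).trans ?_
        have h1 := hinc x y x hx
        have h2 : ‖(τ y : ℂ) * (G x - G y)‖ ≤ η / s * |x - y| := by
          rw [norm_mul, hnorm]
          exact (mul_le_of_le_one_left (norm_nonneg _) (hτ1 y)).trans (h.lipschitz x y hseg)
        calc _ ≤ 3 / s * |x - y| * η + η / s * |x - y| := add_le_add h1 h2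
          _ = _ := by ring

/-- Summation of dyadic pieces. -/
theorem hasWienerBound_of_dyadic {m : ℝ → ℂ} {G : ℕ → ℝ → ℂ} {η : ℕ → ℝ} {B : ℝ}
    (hη : ∀ j, 0 < η j) (hG : ∀ j, Function.Periodic (G j) (2 * Real.pi))
    (h : ∀ j, BoundedAtScale (dyadicScale j) (η j) (G j)) (hB : HasSum η B)
    (hm : ∀ k, HasSum (fun j => (dyadicBump (dyadicScale j) (circDist k) : ℂ) * G j k) (m k)) :
    HasWienerBound m (20 * B) :=
  HasWienerBound.hasSum
    (fun j => (h j).hasWienerBound (dyadicScale_pos j) (dyadicScale_le j) (hη j) (hG j))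
    (hB.mul_left 20) hm

theorem hasSum_dyadicBump_mul {m : ℝ → ℂ} {k : ℝ} (hm : circDist k = 0 → m k = 0) :
    HasSum (fun j => (dyadicBump (dyadicScale j) (circDist k) : ℂ) * m k) (m k) := by
  rcases (circDist_nonneg k).eq_or_lt with hk | hk
  · rw [hm hk.symm]
    simp only [mul_zero, hasSum_zero]
  · have h := hasSum_dyadicBump hk 0
    have h1 : dyadicScale 0 = Real.pi := by simp [dyadicScale]
    rw [h1, cutoff_eq_one Real.pi_pos (circDist_le_pi k)] at h
    have h2 := (h.mapL Complex.ofRealCLM).mul_right (m k)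
    simpa using h2

theorem summable_min_geometric {u q : ℝ} (hu : 0 < u) (hq : 0 < q) (hq1 : q < 1) :
    Summable (fun j : ℕ => min (u * q ^ j) (1 / (u * q ^ j))) ∧
      ∑' j : ℕ, min (u * q ^ j) (1 / (u * q ^ j)) ≤ 2 / (1 - q) := by
  have hgeo := summable_geometric_of_lt_one hq.le hq1
  have hs : Summable (fun j : ℕ => min (u * q ^ j) (1 / (u * q ^ j))) :=
    (hgeo.mul_left u).of_nonneg_of_le (fun j => by positivity) fun j => min_le_left _ _
  refine ⟨hs, ?_⟩
  have hex : ∃ J : ℕ, u * q ^ J ≤ 1 := by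
    obtain ⟨J, hJ⟩ := exists_pow_lt_of_lt_one (show 0 < 1 / u by positivity) hq1
    refine ⟨J, ?_⟩
    rw [lt_div_iff₀ hu] at hJ
    linarith
  classical
  set J := Nat.find hex with hJdef
  have hJ : u * q ^ J ≤ 1 := Nat.find_spec hex
  have h1 : ∑ j ∈ Finset.range J, min (u * q ^ j) (1 / (u * q ^ j)) ≤ 1 / (1 - q) := by
    calc _ ≤ ∑ j ∈ Finset.range J, q ^ (J - 1 - j) := by
          refine Finset.sum_le_sum fun j hj => (min_le_right _ _).trans ?_
          have hj' := Finset.mem_range.1 hj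
          have hlt : 1 < u * q ^ (J - 1) := by
            have := Nat.find_min hex (m := J - 1) (by omega)
            linarith
          rw [div_le_iff₀ (by positivity)]
          calc (1 : ℝ) ≤ u * q ^ (J - 1) := hlt.le
            _ = u * q ^ (J - 1 - j + j) := by congr 2; omega
            _ = _ := by rw [pow_add]; ring
      _ = ∑ j ∈ Finset.range J, q ^ j := Finset.sum_range_reflect (fun i => q ^ i) J
      _ ≤ ∑' j : ℕ, q ^ j := hgeo.sum_le_tsum _ fun _ _ => by positivity
      _ = 1 / (1 - q) := by rw [tsum_geometric_of_lt_one hq.le hq1, one_div]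
  have h2 : ∑' j : ℕ, min (u * q ^ (j + J)) (1 / (u * q ^ (j + J))) ≤ 1 / (1 - q) := by
    rw [one_div, ← tsum_geometric_of_lt_one hq.le hq1]
    refine ((summable_nat_add_iff J).2 hs).tsum_le_tsum (fun j => (min_le_left _ _).trans ?_) hgeo
    rw [pow_add, mul_comm (q ^ j), ← mul_assoc]
    exact mul_le_of_le_one_left (by positivity) hJ
  rw [← hs.sum_add_tsum_nat_add J]
  have : 2 / (1 - q) = 1 / (1 - q) + 1 / (1 - q) := by ring
  linarith

/-! ### Uniform Wiener bounds for the semigroup symbols -/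

theorem norm_exp_sub_exp_le {p q : ℂ} {β : ℝ} (hp : p.re ≤ -β) (hq : q.re ≤ -β) :
    ‖Complex.exp p - Complex.exp q‖ ≤ Real.exp (-β) * ‖p - q‖ := by
  refine (convex_halfSpace_re_le (-β)).norm_image_sub_le_of_norm_deriv_le (𝕜 := ℂ)
    (fun z _ => Complex.differentiableAt_exp) (fun z hz => ?_) hq hp
  rw [Complex.deriv_exp, Complex.norm_exp]
  exact Real.exp_le_exp.2 hz

theorem pow_mul_exp_neg_le {b u : ℝ} (hb : 0 < b) (hu : 0 < u) (n : ℕ) :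
    u ^ n * Real.exp (-(b * u)) ≤ n.factorial / b ^ n := by
  have h := Real.pow_div_factorial_le_exp (b * u) (by positivity) n
  have hf : (0 : ℝ) < n.factorial := by exact_mod_cast n.factorial_pos
  rw [div_le_iff₀ hf] at h
  rw [Real.exp_neg, ← div_eq_mul_inv, div_le_div_iff₀ (Real.exp_pos _) (by positivity),
    ← mul_pow, mul_comm u b, mul_comm (n.factorial : ℝ)]
  exact h

namespace DyadicSymbolBounds

variable {α A b : ℝ} {ψ : ℝ → ℂ}

theorem boundedAtScale (h : DyadicSymbolBounds α A b ψ) {s : ℝ} (hs : 0 < s) :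
    BoundedAtScale s (A * s ^ α) ψ :=
  ⟨fun k => h.norm_le s k hs, fun x y => h.lipschitz s x y hs⟩

theorem re_mul_le (h : DyadicSymbolBounds α A b ψ) {s t : ℝ} (hs : 0 < s) (ht : 0 < t) {k : ℝ}
    (h1 : s / 4 ≤ circDist k) (h2 : circDist k ≤ 4 * s) :
    ((t : ℂ) * ψ k).re ≤ -(b * (t * s ^ α)) := by
  rw [Complex.re_ofReal_mul]
  have := mul_le_mul_of_nonneg_left (h.re_le s k hs h1 h2) ht.le
  linarith

theorem norm_mul_le (h : DyadicSymbolBounds α A b ψ) {s t : ℝ} (hs : 0 < s) (ht : 0 < t) {k : ℝ}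
    (h1 : s / 4 ≤ circDist k) (h2 : circDist k ≤ 4 * s) :
    ‖(t : ℂ) * ψ k‖ ≤ A * (t * s ^ α) := by
  rw [norm_mul, Complex.norm_real, Real.norm_of_nonneg ht.le]
  have := mul_le_mul_of_nonneg_left (h.norm_le s k hs h1 h2) ht.le
  linarith

theorem norm_mul_sub_le (h : DyadicSymbolBounds α A b ψ) {s t : ℝ} (hs : 0 < s) (ht : 0 < t)
    {x y : ℝ} (hxy : ∀ z ∈ uIcc x y, s / 4 ≤ circDist z ∧ circDist z ≤ 4 * s) :
    ‖(t : ℂ) * ψ x - (t : ℂ) * ψ y‖ ≤ A * (t * s ^ α) / s * |x - y| := by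
  rw [← mul_sub, norm_mul, Complex.norm_real, Real.norm_of_nonneg ht.le]
  calc t * ‖ψ x - ψ y‖ ≤ t * (A * s ^ α / s * |x - y|) :=
        mul_le_mul_of_nonneg_left (h.lipschitz s x y hs hxy) ht.le
    _ = _ := by ring

theorem norm_exp_sub_le (h : DyadicSymbolBounds α A b ψ) {s t : ℝ} (hs : 0 < s) (ht : 0 < t)
    {x y : ℝ} (hxy : ∀ z ∈ uIcc x y, s / 4 ≤ circDist z ∧ circDist z ≤ 4 * s) :
    ‖Complex.exp (t * ψ x) - Complex.exp (t * ψ y)‖ ≤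
      A * (t * s ^ α) * Real.exp (-(b * (t * s ^ α))) / s * |x - y| := by
  have hx := hxy x left_mem_uIcc
  have hy := hxy y right_mem_uIcc
  refine (norm_exp_sub_exp_le (h.re_mul_le hs ht hx.1 hx.2) (h.re_mul_le hs ht hy.1 hy.2)).trans ?_
  calc _ ≤ Real.exp (-(b * (t * s ^ α))) * (A * (t * s ^ α) / s * |x - y|) :=
        mul_le_mul_of_nonneg_left (h.norm_mul_sub_le hs ht hxy) (Real.exp_pos _).le
    _ = _ := by ring

theorem norm_exp_le (h : DyadicSymbolBounds α A b ψ) {s t : ℝ} (hs : 0 < s) (ht : 0 < t) {k : ℝ}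
    (h1 : s / 4 ≤ circDist k) (h2 : circDist k ≤ 4 * s) :
    ‖Complex.exp (t * ψ k)‖ ≤ Real.exp (-(b * (t * s ^ α))) := by
  rw [Complex.norm_exp]
  exact Real.exp_le_exp.2 (h.re_mul_le hs ht h1 h2)

theorem boundedAtScale_exp (h : DyadicSymbolBounds α A b ψ) (hA : 0 < A) {s t : ℝ} (hs : 0 < s)
    (ht : 0 < t) :
    BoundedAtScale s ((1 + A * (t * s ^ α)) * Real.exp (-(b * (t * s ^ α))))
      (fun k => Complex.exp (t * ψ k)) := by
  have hu : 0 < t * s ^ α := by positivity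
  refine ⟨fun k h1 h2 => (h.norm_exp_le hs ht h1 h2).trans ?_,
    fun x y hxy => (h.norm_exp_sub_le hs ht hxy).trans ?_⟩
  · exact le_mul_of_one_le_left (Real.exp_pos _).le (le_add_of_nonneg_right (by positivity))
  · gcongr
    exact le_add_of_nonneg_left zero_le_one

theorem boundedAtScale_exp_sub_one (h : DyadicSymbolBounds α A b ψ) (hA : 0 < A) (hb : 0 < b)
    {s t : ℝ} (hs : 0 < s) (ht : 0 < t) :
    BoundedAtScale s (A * (t * s ^ α)) (fun k => Complex.exp (t * ψ k) - 1) := by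
  have hu : 0 < t * s ^ α := by positivity
  refine ⟨fun k h1 h2 => ?_, fun x y hxy => ?_⟩
  · have h0 := norm_exp_sub_exp_le (p := t * ψ k) (q := 0) (β := 0) (by
      rw [Complex.re_ofReal_mul, neg_zero]
      exact mul_nonpos_of_nonneg_of_nonpos ht.le (h.re_nonpos k)) (by simp)
    rw [Complex.exp_zero, neg_zero, Real.exp_zero, one_mul, sub_zero] at h0
    exact h0.trans (h.norm_mul_le hs ht h1 h2)
  · rw [sub_sub_sub_cancel_right]
    refine (h.norm_exp_sub_le hs ht hxy).trans ?_
    have h1 : A * (t * s ^ α) * Real.exp (-(b * (t * s ^ α))) ≤ A * (t * s ^ α) :=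
      mul_le_of_le_one_right (by positivity) (Real.exp_le_one_iff.2 (by
        rw [neg_nonpos]; positivity))
    exact mul_le_mul_of_nonneg_right (div_le_div_of_nonneg_right h1 hs.le) (abs_nonneg _)

theorem boundedAtScale_mul_exp (h : DyadicSymbolBounds α A b ψ) (hA : 0 < A) {s t : ℝ}
    (hs : 0 < s) (ht : 0 < t) :
    BoundedAtScale s (A * (t * s ^ α) * (1 + A * (t * s ^ α)) * Real.exp (-(b * (t * s ^ α))))
      (fun k => t * ψ k * Complex.exp (t * ψ k)) := by
  have hu : 0 < t * s ^ α := by positivity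
  set u := t * s ^ α with hudef
  refine ⟨fun k h1 h2 => ?_, fun x y hxy => ?_⟩
  · rw [norm_mul]
    calc _ ≤ A * u * Real.exp (-(b * u)) :=
          mul_le_mul (h.norm_mul_le hs ht h1 h2) (h.norm_exp_le hs ht h1 h2) (norm_nonneg _)
            (by positivity)
      _ ≤ _ := by
          refine mul_le_mul_of_nonneg_right ?_ (Real.exp_pos _).le
          exact le_mul_of_one_le_right (by positivity) (le_add_of_nonneg_right (by positivity))
  · have hx := hxy x left_mem_uIcc
    have hy := hxy y right_mem_uIcc
    have e : t * ψ x * Complex.exp (t * ψ x) - t * ψ y * Complex.exp (t * ψ y) =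
        (t * ψ x - t * ψ y) * Complex.exp (t * ψ x) +
          t * ψ y * (Complex.exp (t * ψ x) - Complex.exp (t * ψ y)) := by ring
    rw [e]
    refine (norm_add_le _ _).trans ?_
    rw [norm_mul, norm_mul (_ * _)]
    have h1 := mul_le_mul (h.norm_mul_sub_le hs ht hxy) (h.norm_exp_le hs ht hx.1 hx.2)
      (norm_nonneg _) (by positivity)
    have h2 := mul_le_mul (h.norm_mul_le hs ht hy.1 hy.2) (h.norm_exp_sub_le hs ht hxy)
      (norm_nonneg _) (by positivity)
    refine (add_le_add h1 h2).trans (le_of_eq ?_)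
    rw [← hudef]
    ring

theorem exists_hasSum_min (hα : 0 < α) {t : ℝ} (ht : 0 < t) :
    ∃ B, HasSum (fun j => min (t * dyadicScale j ^ α) (1 / (t * dyadicScale j ^ α))) B ∧
      B ≤ 2 / (1 - 2 ^ (-α)) := by
  have hpi := Real.pi_pos
  obtain ⟨h1, h2⟩ := summable_min_geometric (u := t * Real.pi ^ α) (q := 2 ^ (-α)) (by positivity)
    (by positivity) (Real.rpow_lt_one_of_one_lt_of_neg one_lt_two (by linarith))
  refine ⟨_, ?_, h2⟩
  simp only [dyadicScale_rpow, ← mul_assoc]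
  exact h1.hasSum

theorem hasWienerBound_symbol (h : DyadicSymbolBounds α A b ψ) (hα : 0 < α) (hA : 0 < A) :
    ∃ B, HasWienerBound ψ B := by
  have hpi := Real.pi_pos
  have hq : (2 : ℝ) ^ (-α) < 1 := Real.rpow_lt_one_of_one_lt_of_neg one_lt_two (by linarith)
  have hsum := (hasSum_geometric_of_lt_one (r := (2 : ℝ) ^ (-α)) (by positivity) hq).mul_left
    (A * Real.pi ^ α)
  refine ⟨_, hasWienerBound_of_dyadic (G := fun _ => ψ) (fun j => ?_) (fun _ => h.periodic)
    (fun j => (h.boundedAtScale (dyadicScale_pos j)).mono (dyadicScale_pos j) ?_) hsum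
    fun k => hasSum_dyadicBump_mul (h.map_zero k)⟩
  · positivity
  · rw [dyadicScale_rpow, mul_assoc]

theorem hasWienerBound_exp (h : DyadicSymbolBounds α A b ψ) (hα : 0 < α) (hA : 0 < A)
    (hb : 0 < b) {t : ℝ} (ht : 0 < t) :
    HasWienerBound (fun k => Complex.exp (t * ψ k))
      (5 + 20 * ((A + (1 / b + A * (2 / b ^ 2))) * (2 / (1 - 2 ^ (-α))))) := by
  have hpi := Real.pi_pos
  have hq : (2 : ℝ) ^ (-α) < 1 := Real.rpow_lt_one_of_one_lt_of_neg one_lt_two (by linarith)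
  set K := A + (1 / b + A * (2 / b ^ 2)) with hK
  have hK0 : 0 < K := by positivity
  set u : ℕ → ℝ := fun j => t * dyadicScale j ^ α with hu
  have hu0 : ∀ j, 0 < u j := fun j => by
    have := dyadicScale_pos j
    positivity
  have hanti : ∀ i j, i ≤ j → u j ≤ u i := fun i j hij => by
    simp only [hu, dyadicScale_rpow]
    have := pow_le_pow_of_le_one (by positivity : (0 : ℝ) ≤ 2 ^ (-α)) hq.le hij
    gcongr
  have hex : ∃ J, u J ≤ 1 := by
    obtain ⟨J, hJ⟩ := exists_pow_lt_of_lt_one (show 0 < 1 / (t * Real.pi ^ α) by positivity) hq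
    refine ⟨J, ?_⟩
    rw [lt_div_iff₀ (by positivity)] at hJ
    simp only [hu, dyadicScale_rpow]
    linarith
  classical
  set J := Nat.find hex with hJdef
  have hJle : ∀ j, J ≤ j → u j ≤ 1 := fun j hj => (hanti J j hj).trans (Nat.find_spec hex)
  have hJlt : ∀ j, ¬ J ≤ j → 1 < u j := fun j hj => not_le.1 (Nat.find_min hex (not_le.1 hj))
  obtain ⟨B, hB, hB2⟩ := exists_hasSum_min hα ht
  set G : ℕ → ℝ → ℂ := fun j k => Complex.exp (t * ψ k) - (if J ≤ j then 1 else 0) with hG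
  have hbound : ∀ j, BoundedAtScale (dyadicScale j) (K * min (u j) (1 / u j)) (G j) := by
    intro j
    have hj := hu0 j
    by_cases hjJ : J ≤ j
    · have h1 := hJle j hjJ
      have e : G j = fun k => Complex.exp (t * ψ k) - 1 := by
        funext k; simp [hG, hjJ]
      rw [e]
      refine (h.boundedAtScale_exp_sub_one hA hb (dyadicScale_pos j) ht).mono (dyadicScale_pos j) ?_
      rw [min_eq_left (h1.trans (by rw [le_div_iff₀ hj]; linarith))]
      refine mul_le_mul_of_nonneg_right ?_ hj.le
      exact le_add_of_nonneg_right (by positivity)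
    · have h1 := hJlt j hjJ
      have e : G j = fun k => Complex.exp (t * ψ k) := by
        funext k; simp [hG, hjJ]
      rw [e]
      refine (h.boundedAtScale_exp hA (dyadicScale_pos j) ht).mono (dyadicScale_pos j) ?_
      change (1 + A * u j) * Real.exp (-(b * u j)) ≤ _
      rw [min_eq_right (by rw [div_le_iff₀ hj]; nlinarith), mul_one_div, le_div_iff₀ hj]
      have e1 := pow_mul_exp_neg_le hb hj 1
      have e2 := pow_mul_exp_neg_le hb hj 2
      norm_num at e1 e2
      calc (1 + A * u j) * Real.exp (-(b * u j)) * u j =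
          u j * Real.exp (-(b * u j)) + A * (u j ^ 2 * Real.exp (-(b * u j))) := by ring
        _ ≤ 1 / b + A * (2 / b ^ 2) := by
          rw [one_div]
          gcongr
        _ ≤ K := le_add_of_nonneg_left hA.le
  have hmain : HasWienerBound
      (fun k => Complex.exp (t * ψ k) - (cutoff (dyadicScale J) (circDist k) : ℂ))
      (20 * (K * B)) := by
    refine hasWienerBound_of_dyadic (fun j => ?_) (fun j k => ?_) hbound (hB.mul_left K) fun k => ?_
    · have := hu0 j
      positivity
    · simp only [hG, h.periodic k]
    · rcases (circDist_nonneg k).eq_or_lt with hk | hk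
      · have hz : ∀ j, dyadicBump (dyadicScale j) (circDist k) = 0 := fun j =>
          dyadicBump_eq_zero_of_le (dyadicScale_pos j) (by
            rw [← hk]; exact (half_pos (dyadicScale_pos j)).le)
        have hc : cutoff (dyadicScale J) (circDist k) = 1 :=
          cutoff_eq_one (dyadicScale_pos J) (by rw [← hk]; exact (dyadicScale_pos J).le)
        simp [hz, hc, h.map_zero k hk.symm]
      · have h1 := hasSum_dyadicBump_mul (m := fun k => Complex.exp (t * ψ k)) (k := k)
          fun h0 => absurd h0 hk.ne'
        have h2 := (hasSum_dyadicBump hk J).mapL Complex.ofRealCLM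
        convert! h1.sub h2 using 1
        funext j
        by_cases hj : J ≤ j <;> simp [hG, hj, mul_sub]
  have hfin := (hasWienerBound_cutoff (dyadicScale_pos J) (dyadicScale_le J)).add hmain
  simp only [add_sub_cancel] at hfin
  refine hfin.mono ?_
  gcongr

theorem hasWienerBound_mul_exp (h : DyadicSymbolBounds α A b ψ) (hα : 0 < α) (hA : 0 < A)
    (hb : 0 < b) {t : ℝ} (ht : 0 < t) :
    HasWienerBound (fun k => t * ψ k * Complex.exp (t * ψ k))
      (20 * ((A * (1 + A / b) + A * (2 / b ^ 2 + A * (6 / b ^ 3))) * (2 / (1 - 2 ^ (-α))))) := by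
  set K := A * (1 + A / b) + A * (2 / b ^ 2 + A * (6 / b ^ 3)) with hK
  have hK0 : 0 < K := by positivity
  obtain ⟨B, hB, hB2⟩ := exists_hasSum_min hα ht
  have hu0 : ∀ j, 0 < t * dyadicScale j ^ α := fun j => by
    have := dyadicScale_pos j
    positivity
  refine HasWienerBound.mono (hasWienerBound_of_dyadic
    (G := fun _ k => t * ψ k * Complex.exp (t * ψ k)) (fun j => ?_) (fun j k => ?_) (fun j => ?_)
    (hB.mul_left K) fun k => ?_) (by gcongr)
  · have := hu0 j
    positivity
  · simp only [h.periodic k]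
  · refine (h.boundedAtScale_mul_exp hA (dyadicScale_pos j) ht).mono (dyadicScale_pos j) ?_
    have hj := hu0 j
    generalize t * dyadicScale j ^ α = u at hj
    have e1 := pow_mul_exp_neg_le hb hj 1
    have e2 := pow_mul_exp_neg_le hb hj 2
    have e3 := pow_mul_exp_neg_le hb hj 3
    have e0 : Real.exp (-(b * u)) ≤ 1 := Real.exp_le_one_iff.2 (by rw [neg_nonpos]; positivity)
    norm_num [Nat.factorial] at e1 e2 e3
    rw [mul_min_of_nonneg _ _ hK0.le]
    refine le_min ?_ ?_
    · calc A * u * (1 + A * u) * Real.exp (-(b * u)) =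
          (A * (Real.exp (-(b * u)) + A * (u * Real.exp (-(b * u))))) * u := by ring
        _ ≤ (A * (1 + A * b⁻¹)) * u := mul_le_mul_of_nonneg_right (mul_le_mul_of_nonneg_left
          (add_le_add e0 (mul_le_mul_of_nonneg_left e1 hA.le)) hA.le) hj.le
        _ ≤ K * u := by
          gcongr
          rw [hK, ← div_eq_mul_inv]
          exact le_add_of_nonneg_right (by positivity)
    · rw [mul_one_div, le_div_iff₀ hj]
      calc A * u * (1 + A * u) * Real.exp (-(b * u)) * u =
          A * (u ^ 2 * Real.exp (-(b * u)) + A * (u ^ 3 * Real.exp (-(b * u)))) := by ring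
        _ ≤ A * (2 / b ^ 2 + A * (6 / b ^ 3)) :=
          mul_le_mul_of_nonneg_left (add_le_add e2 (mul_le_mul_of_nonneg_left e3 hA.le)) hA.le
        _ ≤ K := le_add_of_nonneg_left (by positivity)
  · exact hasSum_dyadicBump_mul (m := fun k => t * ψ k * Complex.exp (t * ψ k))
      fun h0 => by simp [h.map_zero k h0]

end DyadicSymbolBounds

/-! ### The semigroup generated by a multiplier operator -/

theorem HasWienerBound.const_mul {m : ℝ → ℂ} {B : ℝ} (h : HasWienerBound m B) (w : ℂ) :
    HasWienerBound (fun k => w * m k) (‖w‖ * B) := by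
  obtain ⟨a, h1, h2, h3⟩ := h
  refine ⟨fun n => w * a n, ?_, ?_, fun k => ?_⟩
  · simpa only [norm_mul] using h1.mul_left ‖w‖
  · simp only [norm_mul, tsum_mul_left]
    gcongr
  · simpa only [mul_assoc] using (h3 k).mul_left w

theorem hatF_pow_multiplierOp {m : ℝ → ℂ} (hm : IsL1Multiplier m) (f : L1R) (k : ℝ) (n : ℕ) :
    hatF ((multiplierOp m ^ n) f) k = m k ^ n * hatF f k := by
  induction n with
  | zero => simp
  | succ n ih =>
    rw [pow_succ', mul_apply_eq_comp, hatF_multiplierOp hm, ih]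
    ring

theorem exp_smul_multiplierOp {m : ℝ → ℂ} (hm : IsL1Multiplier m) (z : ℂ) :
    IsL1Multiplier (fun k => Complex.exp (z * m k)) ∧
      multiplierOp (fun k => Complex.exp (z * m k)) = NormedSpace.exp (z • multiplierOp m) := by
  refine isL1Multiplier_of_forall_hatF (hm.1.const_mul z).cexp _ fun f k => ?_
  have e1 := (NormedSpace.exp_series_hasSum_exp' (𝕂 := ℂ) (z • multiplierOp m)).mapL
    (ContinuousLinearMap.apply ℂ L1R f)
  have e2 := e1.mapL (hatFCLM k)
  have e3 := (NormedSpace.exp_series_hasSum_exp' (𝕂 := ℂ) (z * m k)).mul_right (hatF f k)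
  rw [← Complex.exp_eq_exp_ℂ] at e3
  refine e2.unique ?_
  convert! e3 using 1
  funext n
  simp only [ContinuousLinearMap.apply_apply, smul_apply, smul_pow,
    hatFCLM_apply, hatF_smul, hatF_pow_multiplierOp hm, smul_eq_mul]
  ring

section Exp

variable {X : Type*} [NormedAddCommGroup X] [NormedSpace ℂ X] [CompleteSpace X] (T : X →L[ℂ] X)

theorem hasDerivAt_exp_smul_clm (z : ℂ) :
    HasDerivAt (fun w : ℂ => NormedSpace.exp (w • T)) (NormedSpace.exp (z • T) * T) z :=
  hasDerivAt_exp_smul_const T z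

theorem exp_add_smul_clm (z w : ℂ) :
    NormedSpace.exp ((z + w) • T) = NormedSpace.exp (z • T) * NormedSpace.exp (w • T) := by
  let _ : NormedAlgebra ℚ (X →L[ℂ] X) := NormedAlgebra.restrictScalars ℚ ℂ _
  rw [add_smul]
  exact NormedSpace.exp_add_of_commute (((Commute.refl T).smul_left z).smul_right w)

theorem continuous_exp_smul_clm : Continuous fun w : ℂ => NormedSpace.exp (w • T) :=
  continuous_iff_continuousAt.2 fun z => (hasDerivAt_exp_smul_clm T z).continuousAt

theorem isC0Semigroup_exp_smul : IsC0Semigroup fun t : ℝ => NormedSpace.exp ((t : ℂ) • T) where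
  map_zero := by simp
  map_add s t _ _ := by
    rw [Complex.ofReal_add]
    exact exp_add_smul_clm T s t
  continuousOn x := (((continuous_exp_smul_clm T).comp Complex.continuous_ofReal).clm_apply
    continuous_const).continuousOn

theorem isBoundedGenerator_exp_smul :
    IsBoundedGenerator T fun t : ℝ => NormedSpace.exp ((t : ℂ) • T) := by
  intro x
  have h1 := (hasDerivAt_exp_smul_clm T 0).clm_apply (hasDerivAt_const (0 : ℂ) x)
  simp only [zero_smul, NormedSpace.exp_zero, one_mul, map_zero, add_zero] at h1
  have h2 := hasDerivAt_iff_tendsto_slope_zero.1 h1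
  have h3 : Tendsto (fun t : ℝ => (t : ℂ)) (𝓝[>] 0) (𝓝[≠] 0) := by
    refine tendsto_nhdsWithin_iff.2 ⟨?_, ?_⟩
    · exact (Complex.continuous_ofReal.tendsto 0).mono_left nhdsWithin_le_nhds
    · filter_upwards [self_mem_nhdsWithin] with t ht
      simpa using (ne_of_gt ht : t ≠ 0)
  simpa [Function.comp_def] using h2.comp h3

theorem isBoundedAnalyticSemigroup_exp_smul {θ N : ℝ} (h0 : 0 < θ) (hθ : θ ≤ Real.pi / 2)
    (hN : ∀ z ∈ openSector θ, ‖NormedSpace.exp (z • T)‖ ≤ N) :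
    IsBoundedAnalyticSemigroup (fun z : ℂ => NormedSpace.exp (z • T)) θ N where
  angle_pos := h0
  angle_le := hθ
  map_zero := by simp
  map_add z _ w _ := exp_add_smul_clm T z w
  differentiableOn z _ := (hasDerivAt_exp_smul_clm T z).differentiableAt.differentiableWithinAt
  tendsto_zero x := by
    have h := ((continuous_exp_smul_clm T).clm_apply (continuous_const (y := x))).tendsto 0
    simp only [zero_smul, NormedSpace.exp_zero, one_apply_eq_self] at h
    exact h.mono_left nhdsWithin_le_nhds
  norm_le := hN

end Exp

/-! ### Rotation of the symbol into the sector -/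

/-- On the sector of half-angle `arctan (c / (2C))` a rotated symbol remains dissipative. -/
theorem re_rotation_le {c C a : ℝ} (hc : 0 < c) (hC : 0 < C)
    (ha : |a| ≤ Real.arctan (c / (2 * C))) {p : ℂ} {r : ℝ} (hr : 0 ≤ r) (hp : ‖p‖ ≤ C * r)
    (hre : p.re ≤ -c * r) :
    (Complex.exp (a * Complex.I) * p).re ≤ -(c / 2 * Real.cos (Real.arctan (c / (2 * C)))) * r := by
  set θ := Real.arctan (c / (2 * C)) with hθ
  have hθ0 : 0 < θ := Real.arctan_pos.2 (by positivity)
  have hθ1 : θ < Real.pi / 2 := Real.arctan_lt_pi_div_two _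
  have hcos : 0 < Real.cos θ := Real.cos_arctan_pos _
  have hsin : Real.sin θ = c / (2 * C) * Real.cos θ := by
    rw [← Real.tan_mul_cos hcos.ne', hθ, Real.tan_arctan]
  have hcosa : Real.cos θ ≤ Real.cos a := by
    rw [← Real.cos_abs a]
    exact Real.cos_le_cos_of_nonneg_of_le_pi (abs_nonneg a) (by linarith) ha
  have hsina : |Real.sin a| ≤ Real.sin θ := by
    have ha' := abs_le.1 ha
    refine abs_le.2 ⟨?_, ?_⟩
    · rw [← Real.sin_neg]
      exact Real.sin_le_sin_of_le_of_le_pi_div_two (by linarith) (by linarith) ha'.1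
    · exact Real.sin_le_sin_of_le_of_le_pi_div_two (by linarith) (by linarith) ha'.2
  have him : |p.im| ≤ C * r := (Complex.abs_im_le_norm p).trans hp
  rw [Complex.exp_mul_I, ← Complex.ofReal_cos, ← Complex.ofReal_sin]
  simp only [Complex.mul_re, Complex.add_re, Complex.ofReal_re, Complex.I_re, mul_zero,
    Complex.ofReal_im, Complex.I_im, Complex.add_im, Complex.mul_im, mul_one, add_zero,
    zero_add, sub_self]
  have h1 : Real.cos a * p.re ≤ Real.cos θ * (-c * r) := by
    have h2 : 0 ≤ -p.re := by nlinarith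
    nlinarith [mul_le_mul_of_nonneg_right hcosa h2]
  have h2 : -(Real.sin a * p.im) ≤ Real.sin θ * (C * r) := by
    refine (neg_le_abs _).trans ?_
    rw [abs_mul]
    exact mul_le_mul hsina him (abs_nonneg _) ((abs_nonneg _).trans hsina)
  have h3 : Real.sin θ * (C * r) = c / 2 * Real.cos θ * r := by
    rw [hsin]
    field_simp
  linarith

theorem theorem4p1 (α C C' c : ℝ) (hα : 0 < α) (hC : 0 < C) (hC' : 0 < C') (hc : 0 < c) :
    -- the constants depend only on `α`, `C`, `C'`, `c`, not on `ψ`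
    ∃ K M θ N : ℝ, ∀ ψ : ℝ → ℂ, IsAdmissibleSymbol α C C' c ψ →
      -- regularity of the symbol
      (1 / 2 < α → MemW1per 2 ψ) ∧
      (α ≤ 1 / 2 → ∀ r : ℝ, 1 ≤ r → r < 1 / (1 - α) → MemW1per (ENNReal.ofReal r) ψ) ∧
      -- (a)
      (∀ t : ℝ, 0 ≤ t →
        IsL1Multiplier (fun k => Complex.exp (t * ψ k)) ∧
        ‖multiplierOp (fun k => Complex.exp (t * ψ k))‖ ≤ K) ∧
      -- (b)
      (∀ t : ℝ, 0 < t →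
        IsL1Multiplier (fun k => ψ k * Complex.exp (t * ψ k)) ∧
        ‖multiplierOp (fun k => ψ k * Complex.exp (t * ψ k))‖ ≤ M / t) ∧
      -- `T_ψ` generates the semigroup `T_{e^{tψ}}`, which is bounded and analytic
      IsL1Multiplier ψ ∧
      IsC0Semigroup (fun t : ℝ => multiplierOp fun k => Complex.exp (t * ψ k)) ∧
      IsBoundedGenerator (multiplierOp ψ)
        (fun t : ℝ => multiplierOp fun k => Complex.exp (t * ψ k)) ∧
      (∀ z ∈ openSector θ, IsL1Multiplier (fun k => Complex.exp (z * ψ k))) ∧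
      IsBoundedAnalyticSemigroup
        (fun z : ℂ => multiplierOp fun k => Complex.exp (z * ψ k)) θ N := by
  set θ := Real.arctan (c / (2 * C)) with hθ
  have hθ0 : 0 < θ := Real.arctan_pos.2 (by positivity)
  have hcos : 0 < Real.cos θ := Real.cos_arctan_pos _
  set A := C * 4 ^ α + C' * 4 ^ |α - 1| with hA
  set b := c / 2 * Real.cos θ * 4 ^ (-α) with hb
  have hA0 : 0 < A := by positivity
  have hb0 : 0 < b := by positivity
  obtain ⟨N, hN⟩ : ∃ N : ℝ, ∀ ψ, DyadicSymbolBounds α A b ψ → ∀ t : ℝ, 0 < t →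
      HasWienerBound (fun k => Complex.exp (t * ψ k)) N :=
    ⟨_, fun ψ h t ht => h.hasWienerBound_exp hα hA0 hb0 ht⟩
  obtain ⟨M, hM⟩ : ∃ M : ℝ, ∀ ψ, DyadicSymbolBounds α A b ψ → ∀ t : ℝ, 0 < t →
      HasWienerBound (fun k => t * ψ k * Complex.exp (t * ψ k)) M :=
    ⟨_, fun ψ h t ht => h.hasWienerBound_mul_exp hα hA0 hb0 ht⟩
  refine ⟨max 1 N, M, θ, N, fun ψ hψ => ?_⟩
  have hrot : ∀ a : ℝ, |a| ≤ θ →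
      DyadicSymbolBounds α A b (fun k => Complex.exp (a * Complex.I) * ψ k) := fun a ha =>
    hψ.dyadicSymbolBounds hα hC hC' (Complex.norm_exp_ofReal_mul_I a) (by positivity)
      fun k d h1 h2 hd => re_rotation_le hc hC ha (Real.rpow_nonneg hd α) h1 h2
  have h0 : DyadicSymbolBounds α A b ψ := by
    simpa using hrot 0 (by rw [abs_zero]; exact hθ0.le)
  have hmul : IsL1Multiplier ψ := by
    obtain ⟨B, hB⟩ := h0.hasWienerBound_symbol hα hA0
    exact hB.multiplier.1
  have hexp := exp_smul_multiplierOp hmul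
  have hfun : (fun z : ℂ => multiplierOp fun k => Complex.exp (z * ψ k)) =
      fun z => NormedSpace.exp (z • multiplierOp ψ) := funext fun z => (hexp z).2
  have hfun' : (fun t : ℝ => multiplierOp fun k => Complex.exp (t * ψ k)) =
      fun t : ℝ => NormedSpace.exp ((t : ℂ) • multiplierOp ψ) := funext fun t => (hexp t).2
  refine ⟨fun h => ?_, fun h r hr hr' => ?_, fun t ht => ⟨(hexp t).1, ?_⟩, fun t ht => ?_, hmul,
    ?_, ?_, fun z _ => (hexp z).1, ?_⟩
  · have := hψ.memW1per (r := 2) (by norm_num) (by linarith)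
    simpa using this
  · refine hψ.memW1per hr ?_
    rw [lt_div_iff₀ (by linarith)] at hr'
    linarith
  · rcases ht.eq_or_lt with rfl | ht
    · rw [(hexp _).2, Complex.ofReal_zero, zero_smul, NormedSpace.exp_zero]
      exact ContinuousLinearMap.norm_id_le.trans (le_max_left _ _)
    · exact (hN ψ h0 t ht).multiplier.2.trans (le_max_right _ _)
  · have h1 := (hM ψ h0 t ht).const_mul (t : ℂ)⁻¹
    have e : (fun k => (t : ℂ)⁻¹ * (t * ψ k * Complex.exp (t * ψ k))) =
        fun k => ψ k * Complex.exp (t * ψ k) := by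
      funext k
      have : (t : ℂ) ≠ 0 := by exact_mod_cast ht.ne'
      field_simp
    rw [e, norm_inv, Complex.norm_real, Real.norm_of_nonneg ht.le, inv_mul_eq_div] at h1
    exact h1.multiplier
  · rw [hfun']
    exact isC0Semigroup_exp_smul _
  · rw [hfun']
    exact isBoundedGenerator_exp_smul _
  · rw [hfun]
    refine isBoundedAnalyticSemigroup_exp_smul _ hθ0 (Real.arctan_lt_pi_div_two _).le fun z hz => ?_
    have h1 := (hN _ (hrot z.arg hz.2.le) ‖z‖ (norm_pos_iff.2 hz.1)).multiplier.2
    simp only [← mul_assoc, Complex.norm_mul_exp_arg_mul_I] at h1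
    rwa [(hexp z).2] at h1
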